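/- Let $\Omega\subseteq\mathbb H^n\cong\mathbb R^{4n}$ be open, with coordinates $q_l=x_{4l}+\mathbf i x_{4l+1}+\mathbf j x_{4l+2}+\mathbf k x_{4l+3}$, $0\le l\le n-1$, and fix a basis $\omega^0,\dots,\omega^{2n-1}$ of $\mathbb C^{2n}$. *Operators.* Let $\nabla_{(2l)0}=\partial_{x_{4l}}+i\partial_{x_{4l+1}}$, $\nabla_{(2l)1}=-\partial_{x_{4l+2}}-i\partial_{x_{4l+3}}$, $\nabla_{(2l+1)0}=\partial_{x_{4l+2}}-i\partial_{x_{4l+3}}$, $\nabla_{(2l+1)1}=\partial_{x_{4l}}-i\partial_{x_{4l+1}}$. On test $p$-forms $F=\sum_I f_I\omega^I\in\mathcal D^p(\Omega)=C_0^\infty(\Omega,\wedge^p\mathbb C^{2n})$ put $d_\alpha F=\sum_{k,I}\nabla_{k\alpha}f_I\,\omega^k\wedge\omega^I$ ($\alpha=0,1$) and $\triangle F=d_0d_1F$. *Currents.* A $p$-current ($0\le p\le 2n$) is a continuous $\mathbb C$-linear functional on $\mathcal D^{2n-p}(\Omega)$; put $(d_\alpha F)(\eta)=-F(d_\alpha\eta)$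 and $(\triangle F)(\eta)=F(\triangle\eta)$ (currents of degree larger than $2n$ are zero). $F$ is closed if $d_0F=d_1F=0$. A $2k$-current $F$ is positive if $F(\eta)\ge0$ for every $\eta\in\mathcal D^{2n-2k}(\Omega)$ all of whose values are strongly positive, i.e. finite sums with non-negative coefficients of elements $\eta_1^*\tilde\omega^0\wedge\eta_1^*\tilde\omega^1\wedge\dots\wedge\eta_r^*\tilde\omega^0\wedge\eta_r^*\tilde\omega^1$, $r=n-k$, where $\eta_1,\dots,\eta_r:\mathbb H^n\to\mathbb H$ are linearly independent right $\mathbb H$-linear maps. Here, for $\eta(q)=\sum_l g_lq_l$, $\eta^*\tilde\omega^p=\sum_{l}\bigl(\tau(g_l)_{p0}\,\omega^{2l}+\tau(g_l)_{p1}\,\omega^{2l+1}\bigr)$, $p=0,1$, with $\tau(a_0+\mathbf i a_1+\mathbf j a_2+\mathbf k a_3)=\begin{pmatrix}a_0-ia_1&-a_2+ia_3\\a_2+ia_3&a_0+ia_1\end{pmatrix}$. *Products.* If $T=\sum_I T_I\omega^I$ is a current whose coefficients $T_I$ are complex Radon measures on $\Omega$ and $u$ is a locally bounded Borel function on $\Omega$,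 then $uT:=\sum_I uT_I\,\omega^I$. A function $u:\Omega\to[-\infty,\infty)$ is plurisubharmonic (PSH) if it is upper semicontinuous and its restriction to each right quaternionic line $\{a+v\xi:\xi\in\mathbb H\}$, $v\ne0$, is subharmonic. **Proposition.** Let $0\le k\le n$ and let $T$ be a closed positive $2k$-current on $\Omega$. 1. For every locally bounded PSH function $u$ on $\Omega$ the current $uT$ is well defined ($T$ has measure coefficients, and $uT$ is uniquely determined), and $$\triangle u\wedge T:=\triangle(uT)$$ is a closed positive $(2k+2)$-current. 2. For every $p\ge0$ and all locally bounded PSH functions $u_1,\dots,u_p$ on $\Omega$, the current defined inductively by $$\triangle u_1\wedge\dots\wedge\triangle u_p\wedge T:=\triangle\bigl(u_1\,\triangle u_2\wedge\dots\wedge\triangle u_p\wedge T\bigr)$$ is a closed positive $(2k+2p)$-current. -/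

import Mathlib

open scoped Distributions

noncomputable section

/-- The quaternions carry their Borel σ-algebra (so `volume` is Lebesgue measure on `ℍ ≅ ℝ⁴`). -/
instance : MeasurableSpace (Quaternion ℝ) := borel _

instance : BorelSpace (Quaternion ℝ) := ⟨rfl⟩

namespace QuatPluripotential

/-- The flat quaternionic space `ℍⁿ ≅ ℝ⁴ⁿ`, with coordinates
`q_l = x_{4l} + i x_{4l+1} + j x_{4l+2} + k x_{4l+3}`, `l = 0, …, n-1`. -/
abbrev Hn (n : ℕ) : Type := Fin n → Quaternion ℝ

/-! ### The exterior algebra of `ℂ²ⁿ` -/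

/-- Increasing multi-indices of length `p` in `{0, …, 2n-1}`, as subsets with `p` elements. -/
abbrev MultiIndex (n p : ℕ) : Type := {I : Finset (Fin (2 * n)) // I.card = p}

/-- `∧ᵖ ℂ²ⁿ`, in the basis `ω^I` (`I` increasing of length `p`): the element `∑_I f_I ω^I` is
the family `(f_I)_I` of its coefficients. -/
abbrev Ext (n p : ℕ) : Type := MultiIndex n p → ℂ

/-- The number `l` with `j ∈ {2l, 2l+1}`. -/
def quatIndex {n : ℕ} (j : Fin (2 * n)) : Fin n := ⟨j.1 / 2, by omega⟩

/-- The parity of `j`. -/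
def parity {n : ℕ} (j : Fin (2 * n)) : Fin 2 := ⟨j.1 % 2, by omega⟩

/-- The exterior product `F ↦ ω^k ∧ F` from `∧ᵖ ℂ²ⁿ` to `∧^{p'} ℂ²ⁿ`, `p' = p + 1`, that is
`ω^k ∧ ω^I = (-1)^{#{j ∈ I : j < k}} ω^{I ∪ {k}}` for `k ∉ I`, and `0` for `k ∈ I`.
(For `p' ≠ p + 1` this is the zero map.) -/
def leftWedge {n : ℕ} (p p' : ℕ) (k : Fin (2 * n)) : Ext n p →L[ℂ] Ext n p' :=
  ContinuousLinearMap.pi fun J : MultiIndex n p' =>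
    if h : k ∈ J.1 ∧ (J.1.erase k).card = p then
      ((-1 : ℂ) ^ (J.1.filter (· < k)).card) •
        (ContinuousLinearMap.proj (R := ℂ) (φ := fun _ : MultiIndex n p => ℂ)
          ⟨J.1.erase k, h.2⟩)
    else 0

/-- The exterior product `a_0 ∧ ⋯ ∧ a_{p-1}` of vectors `a_i = ∑_j (a_i)_j ω^j` of `ℂ²ⁿ`; its
coefficients are the maximal minors of `(a_i)_j`. -/
def wedgeVectors {n p : ℕ} (a : Fin p → Fin (2 * n) → ℂ) : Ext n p :=
  fun I => Matrix.det (Matrix.of fun i j : Fin p => a i (I.1.orderEmbOfFin I.2 j))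

/-! ### Strongly positive elements -/

/-- The conjugate embedding `τ : ℍ → ℂ^{2×2}`. -/
def tau (q : Quaternion ℝ) : Matrix (Fin 2) (Fin 2) ℂ :=
  !![(q.re : ℂ) - Complex.I * q.imI, -(q.imJ : ℂ) + Complex.I * q.imK;
     (q.imJ : ℂ) + Complex.I * q.imK, (q.re : ℂ) + Complex.I * q.imI]

/-- The complex `2l × 2m` matrix `τ(A)` of a quaternionic `l × m` matrix `A`. -/
def tauMatrix {l m : ℕ} (A : Matrix (Fin l) (Fin m) (Quaternion ℝ)) :
    Matrix (Fin (2 * l)) (Fin (2 * m)) ℂ :=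
  Matrix.of fun i j => tau (A (quatIndex i) (quatIndex j)) (parity i) (parity j)

/-- Elementary strongly positive elements of `∧^{2r} ℂ²ⁿ` (`p = 2r`):
`η₁^*ω̃⁰ ∧ η₁^*ω̃¹ ∧ ⋯ ∧ η_r^*ω̃⁰ ∧ η_r^*ω̃¹` with linearly independent right `ℍ`-linear maps
`η_j : ℍⁿ → ℍ`. The map `η_j(q) = ∑_l g_{jl} q_l` is given by the `j`-th row of `g`; such maps
form a left `ℍ`-vector space, and the pull-backs `η_j^*ω̃⁰`, `η_j^*ω̃¹` are the rows
`2j`, `2j+1` of `τ(g)`. -/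
def IsElementaryStronglyPositive {n p : ℕ} (ω : Ext n p) : Prop :=
  ∃ (r : ℕ) (hr : p = 2 * r) (g : Matrix (Fin r) (Fin n) (Quaternion ℝ)),
    LinearIndependent (Quaternion ℝ) (fun j : Fin r => (g j : Fin n → Quaternion ℝ)) ∧
      ω = wedgeVectors (fun i : Fin p => tauMatrix g (Fin.cast hr i))

/-- The convex cone of strongly positive elements. -/
def IsStronglyPositive {n p : ℕ} (ω : Ext n p) : Prop :=
  ∃ (m : ℕ) (c : Fin m → ℝ) (ξ : Fin m → Ext n p),
    (∀ l, 0 ≤ c l) ∧ (∀ l, IsElementaryStronglyPositive (ξ l)) ∧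
      ω = ∑ l, (c l : ℂ) • ξ l

/-! ### Test forms and the operators `d₀`, `d₁`, `△` -/

variable {n : ℕ} {Ω : TopologicalSpace.Opens (Hn n)}

/-- Test `p`-forms: smooth compactly supported maps from `Ω` to `∧ᵖ ℂ²ⁿ`. -/
abbrev TestForm (Ω : TopologicalSpace.Opens (Hn n)) (p : ℕ) : Type := 𝓓(Ω, Ext n p)

/-- The derivative `∂_v` of test forms in the direction of `v` in the `l`-th quaternionic variable;
for `v = 1, i, j, k` it is `∂_{x_{4l}}, ∂_{x_{4l+1}}, ∂_{x_{4l+2}}, ∂_{x_{4l+3}}`. -/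
def partialQ {p : ℕ} (l : Fin n) (v : Quaternion ℝ) : TestForm Ω p →L[ℂ] TestForm Ω p :=
  TestFunction.lineDerivCLM ℂ (Pi.single l v : Hn n)

/-- Multiplication of test forms by the imaginary unit. -/
def mulI {p : ℕ} : TestForm Ω p →L[ℂ] TestForm Ω p :=
  TestFunction.postcompCLM (Complex.I • ContinuousLinearMap.id ℂ (Ext n p))

/-- The operators `∇_{jα}` applied to the coefficients of test forms:
`∇_{(2l)0} = ∂_{x_{4l}} + i ∂_{x_{4l+1}}`, `∇_{(2l)1} = -∂_{x_{4l+2}} - i ∂_{x_{4l+3}}`,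
`∇_{(2l+1)0} = ∂_{x_{4l+2}} - i ∂_{x_{4l+3}}`, `∇_{(2l+1)1} = ∂_{x_{4l}} - i ∂_{x_{4l+1}}`. -/
def nabla {p : ℕ} (j : Fin (2 * n)) (α : Fin 2) : TestForm Ω p →L[ℂ] TestForm Ω p :=
  let l := quatIndex j
  !![partialQ l ⟨1, 0, 0, 0⟩ + mulI ∘L partialQ l ⟨0, 1, 0, 0⟩,
      -partialQ l ⟨0, 0, 1, 0⟩ - mulI ∘L partialQ l ⟨0, 0, 0, 1⟩;
     partialQ l ⟨0, 0, 1, 0⟩ - mulI ∘L partialQ l ⟨0, 0, 0, 1⟩,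
      partialQ l ⟨1, 0, 0, 0⟩ - mulI ∘L partialQ l ⟨0, 1, 0, 0⟩] (parity j) α

/-- `d_α F = ∑_{k, I} ∇_{kα} f_I ω^k ∧ ω^I`, from test `p`-forms to test `p'`-forms, `p' = p + 1`
(the zero map for `p' ≠ p + 1`). -/
def dForm (p p' : ℕ) (α : Fin 2) : TestForm Ω p →L[ℂ] TestForm Ω p' :=
  ∑ k : Fin (2 * n), TestFunction.postcompCLM (leftWedge p p' k) ∘L nabla k α

/-! ### Currents -/

/-- The `p`-currents on `Ω` (`p ≤ 2n`): the topological dual of the space of test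
`(2n-p)`-forms. -/
abbrev Current (Ω : TopologicalSpace.Opens (Hn n)) (p : ℕ) : Type :=
  TestForm Ω (2 * n - p) →L[ℂ] ℂ

namespace Current

variable {p : ℕ}

/-- `(d_α F)(η) = -F(d_α η)` for test `(2n-p-1)`-forms `η` (so `d_α F = 0` for `p = 2n`). -/
def d (α : Fin 2) (F : Current Ω p) : Current Ω (p + 1) :=
  -(F ∘L dForm (2 * n - (p + 1)) (2 * n - p) α)

/-- `(△F)(η) = F(△η)`, `△η = d₀ d₁ η`, for test `(2n-p-2)`-forms `η` (so `△F = 0` for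
`p > 2n - 2`). -/
def laplace (F : Current Ω p) : Current Ω (p + 2) :=
  F ∘L dForm (2 * n - (p + 1)) (2 * n - p) 0 ∘L dForm (2 * n - (p + 2)) (2 * n - (p + 1)) 1

/-- A current is closed if `d₀ F = d₁ F = 0`. -/
def IsClosed (F : Current Ω p) : Prop := ∀ α : Fin 2, F.d α = 0

/-- A current is positive if it is real and nonnegative on strongly positive test forms. -/
def IsPositive (F : Current Ω p) : Prop :=
  ∀ η : TestForm Ω (2 * n - p), (∀ q ∈ Ω, IsStronglyPositive (η q)) →
    0 ≤ (F η).re ∧ (F η).im = 0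

/-- `T` has measure coefficients: its coefficient at the multi-index complementary to `J` is, up to
the sign `ε` of the complement, the complex Radon measure `h_J μ_J` on `Ω`, that is
`T(φ) = ∑_J ∫ φ_J h_J dμ_J`. -/
def IsRepresentedBy (T : Current Ω p) (μ : MultiIndex n (2 * n - p) → MeasureTheory.Measure (Hn n))
    (h : MultiIndex n (2 * n - p) → Hn n → ℂ) : Prop :=
  (∀ J, MeasureTheory.LocallyIntegrableOn (h J) (Ω : Set (Hn n)) (μ J)) ∧
    ∀ φ : TestForm Ω (2 * n - p), T φ = ∑ J, ∫ x, φ x J * h J x ∂(μ J)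

/-- `S = uT = ∑_I u T_I ω^I`: the coefficients `T_I` are measures, and those of `S` are the
measures `u T_I`. -/
def IsProduct (u : Hn n → ℝ) (T S : Current Ω p) : Prop :=
  ∃ (μ : MultiIndex n (2 * n - p) → MeasureTheory.Measure (Hn n))
    (h : MultiIndex n (2 * n - p) → Hn n → ℂ),
    T.IsRepresentedBy μ h ∧ S.IsRepresentedBy μ (fun J x => (u x : ℂ) * h J x)

open scoped Classical in
/-- The current `uT` (it is `0` if there is no such product). -/
def mul (u : Hn n → ℝ) (T : Current Ω p) : Current Ω p :=
  if h : ∃ S, IsProduct u T S then h.choose else 0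

/-- `△u ∧ T := △(uT)` for a function `u` with values in `[-∞, ∞)` that is finite on `Ω`. -/
def laplaceWedge (u : Hn n → EReal) (T : Current Ω p) : Current Ω (p + 2) :=
  (mul (fun x => (u x).toReal) T).laplace

/-- `△u₁ ∧ ⋯ ∧ △u_m ∧ T := △(u₁ △u₂ ∧ ⋯ ∧ △u_m ∧ T)`, inductively. -/
def laplaceWedges (T : Current Ω p) : (m : ℕ) → (Fin m → Hn n → EReal) → Current Ω (p + 2 * m)
  | 0, _ => T
  | m + 1, u => laplaceWedge (u 0) (laplaceWedges T m (Fin.tail u))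

end Current

/-! ### Plurisubharmonic functions -/

/-- Subharmonicity of `f : U → [-∞, ∞)` on an open set `U ⊆ ℍ ≅ ℝ⁴`: `f` is upper semicontinuous
and `f(c)` is at most the mean of `f` over any closed ball `B ⊆ U` with centre `c`. Here the
inequality `|B| f(c) ≤ ∫_B f` is written for the nonnegative functions `M - f`, with `M` a real
upper bound of `f` on `B`, so that it makes sense for `f` that take the value `-∞`. -/
def IsSubharmonicOn (f : Quaternion ℝ → EReal) (U : Set (Quaternion ℝ)) : Prop :=
  UpperSemicontinuousOn f U ∧ (∀ ξ ∈ U, f ξ < ⊤) ∧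
    ∀ (c : Quaternion ℝ) (r : ℝ), 0 < r → Metric.closedBall c r ⊆ U →
      ∀ M : ℝ, (∀ ξ ∈ Metric.closedBall c r, f ξ ≤ M) →
        ∫⁻ ξ in Metric.closedBall c r, ((M : EReal) - f ξ).toENNReal ≤
          MeasureTheory.volume (Metric.closedBall c r) * ((M : EReal) - f c).toENNReal

/-- Plurisubharmonic functions `u : Ω → [-∞, ∞)`: upper semicontinuous, and subharmonic on each
right quaternionic line `{a + vξ : ξ ∈ ℍ}`. -/
def IsPSH (Ω : TopologicalSpace.Opens (Hn n)) (u : Hn n → EReal) : Prop :=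
  UpperSemicontinuousOn u (Ω : Set (Hn n)) ∧ (∀ q ∈ Ω, u q < ⊤) ∧
    ∀ a v : Hn n, v ≠ 0 →
      IsSubharmonicOn (fun ξ => u (fun l => a l + v l * ξ)) {ξ | (fun l => a l + v l * ξ) ∈ Ω}

/-- Local boundedness on `Ω` (in particular finiteness at every point of `Ω`). -/
def IsLocallyBounded (Ω : TopologicalSpace.Opens (Hn n)) (u : Hn n → EReal) : Prop :=
  ∀ a ∈ Ω, ∃ M : ℝ, ∀ᶠ x in nhds a, ((-M : ℝ) : EReal) ≤ u x ∧ u x ≤ (M : EReal)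

end QuatPluripotential

end

noncomputable section

namespace QuatPluripotential

open scoped ContDiff

variable {n : ℕ} {Ω : TopologicalSpace.Opens (Hn n)}

/-! Unwinding the definitions, `△(uT)(η) = (uT)(△η)`. It is closed for purely algebraic reasons: the
`∇_{jα}` commute and the `ω^k` anticommute, so `d₀` and `d₁` anticommute and square to zero
(`dForm_anticomm`, `dForm_dForm_self`).

Positivity is first proved with a smooth `v` in place of `u`. Since `T` is closed, integrating by
parts twice gives `T(v △η) = T(△v ∧ η)` (`closed_apply_smul_laplace`). The form `△v` depends only on
the part of the Hessian antisymmetrized in the indices of `ω^k ∧ ω^j`, and this part does not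
change, up to the factor 4, when the Hessian is summed over right multiplications by `1, i, j, k`
(`hessCoeff_averagedForm`). Submean values on right quaternionic lines make the summed Hessian
nonnegative (`hess_trace_nonneg`). It is then a sum of squares of real linear functionals, each the
real part of a right `ℍ`-linear map `g`, and such a square contributes `g^*ω̃⁰ ∧ g^*ω̃¹`
(`exists_rowVec_of_nonneg`). Wedging with this preserves strong positivity
(`isStronglyPositive_hess_wedge`), so `T(△v ∧ η) ≥ 0`.

For general `u`, strongly positive elements span all forms of even degree (`spSpan_even`), so the
Riesz representation theorem gives `T` measure coefficients (`exists_representation`). Convolution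
with a product of radial weights yields smooth `v_i` that are uniformly bounded, tend to `u` at
every point of a given compact set and have nonnegative summed Hessian there
(`exists_smooth_approx`). Dominated convergence gives `T(v_i φ) → (uT)(φ)`, which proves both
positivity of `△(uT)` and independence of `uT` from the chosen representation of `T`. The second
part follows by induction on the number of factors. -/

/-- The quaternion `a + b i + c j + d k`. -/
def quat (a b c d : ℝ) : Quaternion ℝ := ⟨a, b, c, d⟩

@[simp] lemma quat_re (a b c d : ℝ) : (quat a b c d).re = a := rfl
@[simp] lemma quat_imI (a b c d : ℝ) : (quat a b c d).imI = b := rfl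
@[simp] lemma quat_imJ (a b c d : ℝ) : (quat a b c d).imJ = c := rfl
@[simp] lemma quat_imK (a b c d : ℝ) : (quat a b c d).imK = d := rfl

/-! ### Calculus of the operators `∇_{jα}` -/

section Calculus

variable {F G : Type*} [NormedAddCommGroup F] [NormedSpace ℝ F] [NormedSpace ℂ F]
  [IsScalarTower ℝ ℂ F] [NormedAddCommGroup G] [NormedSpace ℝ G] [NormedSpace ℂ G]
  [IsScalarTower ℝ ℂ G]

/-- The real part of the complex vector field `∇_{jα}`. -/
def dirRe (j : Fin (2 * n)) (α : Fin 2) : Hn n :=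
  Pi.single (quatIndex j) ((!![quat 1 0 0 0, quat 0 0 (-1) 0; quat 0 0 1 0, quat 1 0 0 0] :
    Matrix (Fin 2) (Fin 2) (Quaternion ℝ)) (parity j) α)

/-- The imaginary part of the complex vector field `∇_{jα}`. -/
def dirIm (j : Fin (2 * n)) (α : Fin 2) : Hn n :=
  Pi.single (quatIndex j) ((!![quat 0 1 0 0, quat 0 0 0 (-1); quat 0 0 0 (-1), quat 0 (-1) 0 0] :
    Matrix (Fin 2) (Fin 2) (Quaternion ℝ)) (parity j) α)

/-- The operator `∇_{jα}` on functions with values in a complex normed space. -/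
def nablaFun (j : Fin (2 * n)) (α : Fin 2) (f : Hn n → F) (x : Hn n) : F :=
  fderiv ℝ f x (dirRe j α) + Complex.I • fderiv ℝ f x (dirIm j α)

lemma contDiff_nablaFun (j : Fin (2 * n)) (α : Fin 2) {f : Hn n → F} (hf : ContDiff ℝ ∞ f) :
    ContDiff ℝ ∞ (nablaFun j α f) := by
  have h : ContDiff ℝ ∞ (fderiv ℝ f) := hf.fderiv_right (by simp)
  have h2 : ContDiff ℝ ∞ (fun x => fderiv ℝ f x (dirIm j α)) := h.clm_apply contDiff_const
  exact (h.clm_apply contDiff_const).add (contDiff_const.smul h2)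

lemma nablaFun_clm_comp (j : Fin (2 * n)) (α : Fin 2) (A : F →L[ℂ] G) {f : Hn n → F}
    (hf : Differentiable ℝ f) (x : Hn n) :
    nablaFun j α (fun y => A (f y)) x = A (nablaFun j α f x) := by
  have h : HasFDerivAt (fun y => A (f y)) ((A.restrictScalars ℝ).comp (fderiv ℝ f x)) x :=
    (A.restrictScalars ℝ).hasFDerivAt.comp x (hf x).hasFDerivAt
  simp [nablaFun, h.fderiv]

lemma nablaFun_smul (j : Fin (2 * n)) (α : Fin 2) {v : Hn n → ℂ} {f : Hn n → F}
    (hv : Differentiable ℝ v) (hf : Differentiable ℝ f) (x : Hn n) :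
    nablaFun j α (fun y => v y • f y) x
      = v x • nablaFun j α f x + nablaFun j α v x • f x := by
  have h := ((hv x).hasFDerivAt.smul (hf x).hasFDerivAt).fderiv
  have h' : fderiv ℝ (fun y => v y • f y) x = v x • fderiv ℝ f x + (fderiv ℝ v x).smulRight (f x) := h
  simp only [nablaFun, h']
  simp [smul_add, add_smul, smul_smul, mul_comm]
  abel

lemma nablaFun_sum {F : Type*} [NormedAddCommGroup F] [NormedSpace ℝ F] [NormedSpace ℂ F]
    {ι : Type*} (s : Finset ι) (j : Fin (2 * n)) (α : Fin 2) {f : ι → Hn n → F}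
    (hf : ∀ i ∈ s, Differentiable ℝ (f i)) (x : Hn n) :
    nablaFun j α (fun y => ∑ i ∈ s, f i y) x = ∑ i ∈ s, nablaFun j α (f i) x := by
  have h := fderiv_fun_sum (𝕜 := ℝ) (x := x) (u := s) (A := f) (fun i hi => hf i hi x)
  simp [nablaFun, h, Finset.smul_sum, Finset.sum_add_distrib]

/-- The operators `∇_{jα}` commute with each other. -/
lemma nablaFun_nablaFun (j k : Fin (2 * n)) (α β : Fin 2) {f : Hn n → F} (hf : ContDiff ℝ ∞ f)
    (x : Hn n) : nablaFun j α (nablaFun k β f) x =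
      (fderiv ℝ (fderiv ℝ f) x (dirRe j α) (dirRe k β)
        + Complex.I • fderiv ℝ (fderiv ℝ f) x (dirRe j α) (dirIm k β))
      + Complex.I • (fderiv ℝ (fderiv ℝ f) x (dirIm j α) (dirRe k β)
        + Complex.I • fderiv ℝ (fderiv ℝ f) x (dirIm j α) (dirIm k β)) := by
  have h : Differentiable ℝ (fderiv ℝ f) :=
    (hf.fderiv_right (m := ∞) (by simp)).differentiable (by simp)
  have h1 (w : Hn n) : HasFDerivAt (fun y => fderiv ℝ f y w)
      ((fderiv ℝ (fderiv ℝ f) x).flip w) x := by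
    simpa using (h x).hasFDerivAt.clm_apply (hasFDerivAt_const w x)
  have h2 := ((h1 (dirRe k β)).add ((h1 (dirIm k β)).const_smul Complex.I)).fderiv
  have h3 : fderiv ℝ (nablaFun k β f) x = (fderiv ℝ (fderiv ℝ f) x).flip (dirRe k β)
      + Complex.I • (fderiv ℝ (fderiv ℝ f) x).flip (dirIm k β) := h2
  rw [nablaFun, h3]
  simp

/-- Constant coefficient operators commute because the second derivative is symmetric. -/
lemma nablaFun_comm (j k : Fin (2 * n)) (α β : Fin 2) {f : Hn n → F} (hf : ContDiff ℝ ∞ f)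
    (x : Hn n) : nablaFun j α (nablaFun k β f) x = nablaFun k β (nablaFun j α f) x := by
  have hs : IsSymmSndFDerivAt ℝ f x :=
    hf.contDiffAt.isSymmSndFDerivAt (by simpa using WithTop.coe_le_coe.2 (le_top (a := (2 : ℕ∞))))
  rw [nablaFun_nablaFun _ _ _ _ hf, nablaFun_nablaFun _ _ _ _ hf,
    hs.eq (dirRe j α) (dirRe k β), hs.eq (dirRe j α) (dirIm k β), hs.eq (dirIm j α) (dirRe k β),
    hs.eq (dirIm j α) (dirIm k β)]
  simp only [smul_add]
  abel

end Calculus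

/-! ### Pointwise formulas for the operators on test forms -/

lemma fin_two_cases (a : Fin 2) : a = 0 ∨ a = 1 := by omega

lemma partialQ_apply {p : ℕ} (l : Fin n) (v : Quaternion ℝ) (φ : TestForm Ω p) (x : Hn n) :
    partialQ l v φ x = fderiv ℝ φ x (Pi.single l v) := by
  rw [partialQ, TestFunction.lineDerivCLM_eq_fderivCLM, TestFunction.fderivCLM_apply_of_le]
  simp

lemma mulI_apply {p : ℕ} (φ : TestForm Ω p) (x : Hn n) :
    mulI φ x = Complex.I • φ x := by
  simp [mulI]

/-- Bridge from bundled test forms to plain functions, where the product rule is also available for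
factors without compact support. The minus signs in `∇_{jα}` are absorbed into the directions
`dirRe`, `dirIm`. -/
lemma nabla_apply {p : ℕ} (j : Fin (2 * n)) (α : Fin 2) (φ : TestForm Ω p) (x : Hn n) :
    nabla j α φ x = nablaFun j α φ x := by
  have hneg (l : Fin n) (q q' : Quaternion ℝ) (h : q' = -q) :
      fderiv ℝ φ x (Pi.single l q') = - fderiv ℝ φ x (Pi.single l q) := by
    rw [h, Pi.single_neg, map_neg]
  have e1 : quat 0 0 (-1) 0 = -quat 0 0 1 0 := by ext <;> simp
  have e2 : quat 0 0 0 (-1) = -quat 0 0 0 1 := by ext <;> simp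
  have e3 : quat 0 (-1) 0 0 = -quat 0 1 0 0 := by ext <;> simp
  rcases fin_two_cases (parity j) with h | h <;> rcases fin_two_cases α with h' | h' <;>
    simp only [nabla, nablaFun, dirRe, dirIm, h, h']
  · exact congrArg₂ (· + ·) (partialQ_apply _ _ φ x)
      ((mulI_apply _ x).trans (congrArg (Complex.I • ·) (partialQ_apply _ _ φ x)))
  · refine (congrArg₂ (· - ·) (congrArg Neg.neg (partialQ_apply _ _ φ x))
      ((mulI_apply _ x).trans (congrArg (Complex.I • ·) (partialQ_apply _ _ φ x)))).trans ?_
    refine Eq.trans ?_ (congrArg₂ (· + ·) (hneg _ _ _ e1)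
      (congrArg (Complex.I • ·) (hneg _ _ _ e2))).symm
    simp only [smul_neg, sub_eq_add_neg]
    rfl
  · refine (congrArg₂ (· - ·) (partialQ_apply _ _ φ x)
      ((mulI_apply _ x).trans (congrArg (Complex.I • ·) (partialQ_apply _ _ φ x)))).trans ?_
    refine Eq.trans ?_ (congrArg₂ (· + ·) rfl
      (congrArg (Complex.I • ·) (hneg _ _ _ e2))).symm
    simp only [smul_neg, sub_eq_add_neg]
    rfl
  · refine (congrArg₂ (· - ·) (partialQ_apply _ _ φ x)
      ((mulI_apply _ x).trans (congrArg (Complex.I • ·) (partialQ_apply _ _ φ x)))).trans ?_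
    refine Eq.trans ?_ (congrArg₂ (· + ·) rfl
      (congrArg (Complex.I • ·) (hneg _ _ _ e3))).symm
    simp only [smul_neg, sub_eq_add_neg]
    rfl

/-- The operator `d_α` on functions with values in the exterior algebra. -/
def dFun (p p' : ℕ) (α : Fin 2) (f : Hn n → Ext n p) (x : Hn n) : Ext n p' :=
  ∑ k, leftWedge p p' k (nablaFun k α f x)

lemma dForm_apply (p p' : ℕ) (α : Fin 2) (φ : TestForm Ω p) (x : Hn n) :
    dForm p p' α φ x = dFun p p' α φ x := by
  simp [dForm, dFun, nabla_apply]

lemma coe_dForm (p p' : ℕ) (α : Fin 2) (φ : TestForm Ω p) :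
    (dForm p p' α φ : Hn n → Ext n p') = dFun p p' α φ :=
  funext (dForm_apply p p' α φ)

/-! ### Exterior multiplication -/

/-- The coefficient of `ω^I` in `F`, which is `0` if `I` does not have `p` elements. -/
def coeff {p : ℕ} (F : Ext n p) (I : Finset (Fin (2 * n))) : ℂ :=
  if h : I.card = p then F ⟨I, h⟩ else 0

lemma leftWedge_apply {p p' : ℕ} (k : Fin (2 * n)) (F : Ext n p) (J : MultiIndex n p') :
    leftWedge p p' k F J =
      if k ∈ J.1 then (-1) ^ (J.1.filter (· < k)).card * coeff F (J.1.erase k) else 0 := by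
  unfold leftWedge coeff
  by_cases h : k ∈ J.1 <;> by_cases h' : (J.1.erase k).card = p <;>
    simp [h, h', -Finset.card_erase_of_mem]

lemma coeff_leftWedge {p p' : ℕ} (k : Fin (2 * n)) (F : Ext n p) (J : Finset (Fin (2 * n))) :
    coeff (leftWedge p p' k F) J = if J.card = p' then
      if k ∈ J then (-1) ^ (J.filter (· < k)).card * coeff F (J.erase k) else 0 else 0 := by
  by_cases h : J.card = p'
  · simp [coeff, h, leftWedge_apply]
  · simp [coeff, h]

lemma leftWedge_eq_zero {p p' : ℕ} (h : p' ≠ p + 1) (k : Fin (2 * n)) :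
    leftWedge p p' k = 0 := by
  ext F J
  rw [leftWedge_apply]
  split_ifs with hk
  · have : (J.1.erase k).card ≠ p := by
      rw [Finset.card_erase_of_mem hk, J.2]
      have := Finset.card_pos.2 ⟨k, hk⟩
      have := J.2
      omega
    simp [coeff, this]
  · simp

lemma leftWedge_anticomm_of_lt {p₁ p₂ p₃ : ℕ} {j k : Fin (2 * n)} (hjk : j < k) (F : Ext n p₁) :
    leftWedge p₂ p₃ j (leftWedge p₁ p₂ k F) = - leftWedge p₂ p₃ k (leftWedge p₁ p₂ j F) := by
  ext J
  have hne : j ≠ k := hjk.ne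
  simp only [leftWedge_apply, Pi.neg_apply, coeff_leftWedge]
  by_cases hj : j ∈ J.1 <;> by_cases hk : k ∈ J.1 <;> simp [hj, hk, hne, hne.symm, -Finset.card_erase_of_mem]
  have h1 : (J.1.erase j).card = (J.1.erase k).card := by
    rw [Finset.card_erase_of_mem hj, Finset.card_erase_of_mem hk]
  -- As `j < k`, removing `k` leaves the count below `j` alone, while removing `j` lowers the count
  -- below `k` by one: this is the sign.
  have h2 : (J.1.erase k).filter (· < j) = J.1.filter (· < j) := by
    ext i; simp only [Finset.mem_filter, Finset.mem_erase]; grind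
  have h3 : (J.1.filter (· < k)).card = ((J.1.erase j).filter (· < k)).card + 1 := by
    rw [Finset.filter_erase, Finset.card_erase_add_one (by simp [hj, hjk])]
  rw [h1, h2, h3, Finset.erase_right_comm]
  split_ifs <;> ring

lemma leftWedge_anticomm {p₁ p₂ p₃ : ℕ} (j k : Fin (2 * n)) (F : Ext n p₁) :
    leftWedge p₂ p₃ j (leftWedge p₁ p₂ k F) = - leftWedge p₂ p₃ k (leftWedge p₁ p₂ j F) := by
  rcases lt_trichotomy j k with h | h | h
  · exact leftWedge_anticomm_of_lt h F
  · subst h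
    ext J
    simp [leftWedge_apply, coeff_leftWedge]
  · rw [leftWedge_anticomm_of_lt h F, neg_neg]

/-- Exterior multiplication by the vector `∑_k a_k ω^k`. -/
def vecWedge (p p' : ℕ) (a : Fin (2 * n) → ℂ) : Ext n p →ₗ[ℂ] Ext n p' :=
  ∑ k, a k • (leftWedge p p' k).toLinearMap

lemma vecWedge_apply {p p' : ℕ} (a : Fin (2 * n) → ℂ) (F : Ext n p) :
    vecWedge p p' a F = ∑ k, a k • leftWedge p p' k F := by
  simp [vecWedge, LinearMap.sum_apply]

lemma vecWedge_add_left {p p' : ℕ} (a b : Fin (2 * n) → ℂ) :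
    vecWedge p p' (a + b) = vecWedge p p' a + vecWedge p p' b := by
  simp [vecWedge, add_smul, Finset.sum_add_distrib]

lemma vecWedge_smul_left {p p' : ℕ} (c : ℂ) (a : Fin (2 * n) → ℂ) :
    vecWedge p p' (c • a) = c • vecWedge p p' a := by
  simp [vecWedge, Finset.smul_sum, smul_smul]

lemma vecWedge_single {p p' : ℕ} (k : Fin (2 * n)) :
    vecWedge p p' (Pi.single k 1) = (leftWedge p p' k).toLinearMap := by
  simp [vecWedge, Pi.single_apply]

/-- Turns the sign exponent in `leftWedge` into the column index of the Laplace expansion. -/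
lemma card_filter_lt_orderEmbOfFin {m : ℕ} {J : Finset (Fin (2 * n))} (h : J.card = m)
    (i : Fin m) : (J.filter (· < J.orderEmbOfFin h i)).card = i := by
  have : J.filter (· < J.orderEmbOfFin h i)
      = (Finset.Iio i).map (J.orderEmbOfFin h).toEmbedding := by
    ext x
    have hx : x ∈ J ↔ ∃ j, J.orderEmbOfFin h j = x := by
      rw [← Set.mem_range, Finset.range_orderEmbOfFin, Finset.mem_coe]
    simp only [Finset.mem_filter, hx, Finset.mem_map, Finset.mem_Iio,
      RelEmbedding.coe_toEmbedding]
    constructor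
    · rintro ⟨⟨j, rfl⟩, hj⟩
      exact ⟨j, by simpa using hj, rfl⟩
    · rintro ⟨j, hj, rfl⟩
      exact ⟨⟨j, rfl⟩, by simpa using hj⟩
  rw [this, Finset.card_map, Fin.card_Iio]

lemma orderEmbOfFin_erase {m : ℕ} {J : Finset (Fin (2 * n))} (h : J.card = m + 1)
    (i : Fin (m + 1)) (h' : (J.erase (J.orderEmbOfFin h i)).card = m) (j : Fin m) :
    (J.erase (J.orderEmbOfFin h i)).orderEmbOfFin h' j = J.orderEmbOfFin h (i.succAbove j) := by
  have := Finset.orderEmbOfFin_unique h' (f := fun j => J.orderEmbOfFin h (i.succAbove j))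
    (fun x => by simp [Fin.succAbove_ne])
    (fun a b hab => (J.orderEmbOfFin h).strictMono (Fin.strictMono_succAbove i hab))
  exact (congrFun this j).symm

/-- Exterior multiplication of a decomposable form by a vector (Laplace expansion). -/
lemma vecWedge_wedgeVectors {p : ℕ} (a : Fin (2 * n) → ℂ) (c : Fin p → Fin (2 * n) → ℂ) :
    vecWedge p (p + 1) a (wedgeVectors c) =
      wedgeVectors (Fin.cons a c : Fin (p + 1) → Fin (2 * n) → ℂ) := by
  ext J
  obtain ⟨J, hJ⟩ := J
  rw [vecWedge_apply]
  simp only [Finset.sum_apply, Pi.smul_apply, leftWedge_apply, smul_eq_mul, mul_ite, mul_zero]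
  rw [← Finset.sum_filter, Finset.filter_mem_eq_inter, Finset.univ_inter]
  conv_lhs => rw [← Finset.map_orderEmbOfFin_univ J hJ]
  rw [Finset.sum_map, wedgeVectors, Matrix.det_succ_row_zero]
  refine Finset.sum_congr rfl fun i _ => ?_
  have h' : (J.erase (J.orderEmbOfFin hJ i)).card = p := by
    rw [Finset.card_erase_of_mem (Finset.orderEmbOfFin_mem J hJ i), hJ]; rfl
  simp only [RelEmbedding.coe_toEmbedding, Finset.map_orderEmbOfFin_univ,
    card_filter_lt_orderEmbOfFin, Matrix.of_apply, Fin.cons_zero]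
  have : coeff (wedgeVectors c) (J.erase (J.orderEmbOfFin hJ i)) = Matrix.det
      ((Matrix.of fun i j => (Fin.cons a c : Fin (p + 1) → Fin (2 * n) → ℂ) i
        (J.orderEmbOfFin hJ j)).submatrix Fin.succ i.succAbove) := by
    rw [coeff, dif_pos h', wedgeVectors]
    congr 1
    ext x y
    simp [orderEmbOfFin_erase]
  rw [this]
  ring

end QuatPluripotential

end

noncomputable section

namespace QuatPluripotential

variable {n : ℕ}

/-! ### The cone of strongly positive elements -/

lemma IsElementaryStronglyPositive.isStronglyPositive {p : ℕ} {ω : Ext n p}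
    (h : IsElementaryStronglyPositive ω) : IsStronglyPositive ω :=
  ⟨1, fun _ => 1, fun _ => ω, fun _ => zero_le_one, fun _ => h, by simp⟩

lemma isStronglyPositive_zero {p : ℕ} : IsStronglyPositive (0 : Ext n p) :=
  ⟨0, Fin.elim0, Fin.elim0, fun l => l.elim0, fun l => l.elim0, by simp⟩

lemma IsStronglyPositive.add {p : ℕ} {ω ω' : Ext n p} (h : IsStronglyPositive ω)
    (h' : IsStronglyPositive ω') : IsStronglyPositive (ω + ω') := by
  obtain ⟨m, c, ξ, hc, hξ, rfl⟩ := h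
  obtain ⟨m', c', ξ', hc', hξ', rfl⟩ := h'
  refine ⟨m + m', Fin.append c c', Fin.append ξ ξ', ?_, ?_, ?_⟩
  · intro l
    refine Fin.addCases (fun i => ?_) (fun i => ?_) l
    · simpa using hc i
    · simpa using hc' i
  · intro l
    refine Fin.addCases (fun i => ?_) (fun i => ?_) l
    · simpa using hξ i
    · simpa using hξ' i
  · simp [Fin.sum_univ_add]

lemma IsStronglyPositive.smul {p : ℕ} {ω : Ext n p} (h : IsStronglyPositive ω) {t : ℝ}
    (ht : 0 ≤ t) : IsStronglyPositive ((t : ℂ) • ω) := by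
  obtain ⟨m, c, ξ, hc, hξ, rfl⟩ := h
  exact ⟨m, fun l => t * c l, ξ, fun l => mul_nonneg ht (hc l), hξ, by
    simp only [Finset.smul_sum, smul_smul, Complex.ofReal_mul]⟩

lemma isStronglyPositive_sum {p : ℕ} {ι : Type*} (s : Finset ι) {ω : ι → Ext n p}
    (h : ∀ i ∈ s, IsStronglyPositive (ω i)) : IsStronglyPositive (∑ i ∈ s, ω i) := by
  classical
  induction s using Finset.induction_on with
  | empty => simpa using isStronglyPositive_zero
  | insert a s ha ih =>
    rw [Finset.sum_insert ha]
    exact (h a (by simp)).add (ih fun i hi => h i (by simp [hi]))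

lemma tau_mul (p q : Quaternion ℝ) : tau (p * q) = tau p * tau q := by
  ext i j
  rcases fin_two_cases i with rfl | rfl <;> rcases fin_two_cases j with rfl | rfl <;>
    simp [tau, Matrix.mul_apply, Fin.sum_univ_two] <;> ring_nf <;> simp <;> ring

lemma tau_add (p q : Quaternion ℝ) : tau (p + q) = tau p + tau q := by
  ext i j
  rcases fin_two_cases i with rfl | rfl <;> rcases fin_two_cases j with rfl | rfl <;>
    simp [tau] <;> ring

lemma tau_zero : tau 0 = 0 := by
  ext i j
  rcases fin_two_cases i with rfl | rfl <;> rcases fin_two_cases j with rfl | rfl <;>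
    simp [tau, Quaternion.re_zero, Quaternion.imI_zero, Quaternion.imJ_zero, Quaternion.imK_zero]

/-- The pull-backs `η^*ω̃⁰`, `η^*ω̃¹` for `η(q) = ∑_l g_l q_l`. -/
def rowVec (g : Fin n → Quaternion ℝ) (β : Fin 2) : Fin (2 * n) → ℂ :=
  fun j => tau (g (quatIndex j)) β (parity j)

lemma rowVec_add (g h : Fin n → Quaternion ℝ) (β : Fin 2) :
    rowVec (g + h) β = rowVec g β + rowVec h β := by
  ext j
  simp [rowVec, tau_add]

/-- Multiplicativity of `tau`: quaternionic combinations of rows become complex combinations of the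
pairs of pull-backs. -/
lemma rowVec_smul (c : Quaternion ℝ) (g : Fin n → Quaternion ℝ) (β : Fin 2) :
    rowVec (c • g) β = tau c β 0 • rowVec g 0 + tau c β 1 • rowVec g 1 := by
  ext j
  simp [rowVec, tau_mul, Matrix.mul_apply, Fin.sum_univ_two]

lemma rowVec_zero (β : Fin 2) : rowVec (0 : Fin n → Quaternion ℝ) β = 0 := by
  ext j
  simp [rowVec, tau_zero]

/-- By linearity the vector may be taken among the factors, where a determinant with two equal rows
appears. -/
lemma vecWedge_eq_zero_of_mem_span {p : ℕ} {a : Fin (2 * n) → ℂ} {c : Fin p → Fin (2 * n) → ℂ}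
    (ha : a ∈ Submodule.span ℂ (Set.range c)) :
    vecWedge p (p + 1) a (wedgeVectors c) = 0 := by
  induction ha using Submodule.span_induction with
  | mem x hx =>
    obtain ⟨i, rfl⟩ := hx
    rw [vecWedge_wedgeVectors]
    ext J
    refine Matrix.det_zero_of_row_eq (i := 0) (j := i.succ) (Fin.succ_ne_zero i).symm ?_
    ext k
    simp
  | zero => simp [vecWedge]
  | add x y _ _ hx hy => simp [vecWedge_add_left, hx, hy]
  | smul t x _ hx => simp [vecWedge_smul_left, hx]

lemma tauMatrix_apply {r : ℕ} (g : Matrix (Fin r) (Fin n) (Quaternion ℝ)) (i : Fin (2 * r)) :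
    tauMatrix g i = rowVec (g (quatIndex i)) (parity i) := rfl

/-- The product of an elementary strongly positive element with `η^*ω̃⁰ ∧ η^*ω̃¹`. -/
lemma IsElementaryStronglyPositive.wedge {p : ℕ} {ω : Ext n p}
    (h : IsElementaryStronglyPositive ω) (g₀ : Fin n → Quaternion ℝ) :
    IsStronglyPositive (vecWedge (p + 1) (p + 2) (rowVec g₀ 0)
      (vecWedge p (p + 1) (rowVec g₀ 1) ω)) := by
  obtain ⟨r, rfl, g, hg, rfl⟩ := h
  simp only [Fin.cast_eq_self]
  -- If `g₀` depends on the rows of `g`, its pull-back lies in the complex span of the factors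
  -- already present and the product is 0. Otherwise `g₀` can be added as a new first row.
  by_cases hg₀ : g₀ ∈ Submodule.span (Quaternion ℝ) (Set.range g)
  · have : rowVec g₀ 1 ∈ Submodule.span ℂ (Set.range fun i => tauMatrix g i) := by
      have key (β : Fin 2) : rowVec g₀ β ∈ Submodule.span ℂ (Set.range fun i => tauMatrix g i) := by
        induction hg₀ using Submodule.span_induction generalizing β with
        | mem x hx =>
          obtain ⟨i, rfl⟩ := hx
          refine Submodule.subset_span ⟨⟨2 * i + β, by omega⟩, ?_⟩
          have h1 : quatIndex (⟨2 * i + β, by omega⟩ : Fin (2 * r)) = i := by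
            ext; simp [quatIndex]; omega
          have h2 : parity (⟨2 * i + β, by omega⟩ : Fin (2 * r)) = β := by
            ext; simp [parity]; omega
          simp only [tauMatrix_apply, h1, h2]
        | zero => rw [rowVec_zero]; exact Submodule.zero_mem _
        | add x y _ _ hx hy => rw [rowVec_add]; exact Submodule.add_mem _ (hx β) (hy β)
        | smul c x _ hx =>
          rw [rowVec_smul]
          exact Submodule.add_mem _ (Submodule.smul_mem _ _ (hx 0))
            (Submodule.smul_mem _ _ (hx 1))
      exact key 1
    rw [vecWedge_eq_zero_of_mem_span this, map_zero]
    exact isStronglyPositive_zero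
  · refine IsElementaryStronglyPositive.isStronglyPositive
      ⟨r + 1, by ring, (Fin.cons g₀ g : Fin (r + 1) → Fin n → Quaternion ℝ),
        LinearIndependent.finCons hg hg₀, ?_⟩
    rw [vecWedge_wedgeVectors, vecWedge_wedgeVectors]
    congr 1
    ext i : 1
    change _ = rowVec ((Fin.cons g₀ g : Fin (r + 1) → Fin n → Quaternion ℝ) (quatIndex _)) (parity _)
    refine Fin.cases ?_ (fun i => Fin.cases ?_ (fun i => ?_) i) i
    · have h1 : quatIndex (n := r + 1) (Fin.cast (by ring) (0 : Fin (2 * r + 1 + 1))) = 0 := by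
        ext; simp [quatIndex]
      have h2 : parity (n := r + 1) (Fin.cast (by ring) (0 : Fin (2 * r + 1 + 1))) = 0 := by
        ext; simp [parity]
      rw [h1, h2]
      rfl
    · have h1 : quatIndex (n := r + 1) (Fin.cast (by ring) (Fin.succ (0 : Fin (2 * r + 1)))) = 0 := by
        ext; simp [quatIndex]; exact Nat.mod_le _ _
      have h2 : parity (n := r + 1) (Fin.cast (by ring) (Fin.succ (0 : Fin (2 * r + 1)))) = 1 := by
        ext; simp [parity]
      rw [h1, h2]
      rfl
    · have h1 : quatIndex (n := r + 1) (Fin.cast (by ring) (Fin.succ (Fin.succ i)))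
          = (quatIndex i).succ := by
        ext; simp [quatIndex]; omega
      have h2 : parity (n := r + 1) (Fin.cast (by ring) (Fin.succ (Fin.succ i))) = parity i := by
        ext; simp [parity]; omega
      rw [h1, h2]
      rfl

lemma IsStronglyPositive.wedge {p : ℕ} {ω : Ext n p} (h : IsStronglyPositive ω)
    (g₀ : Fin n → Quaternion ℝ) :
    IsStronglyPositive (vecWedge (p + 1) (p + 2) (rowVec g₀ 0)
      (vecWedge p (p + 1) (rowVec g₀ 1) ω)) := by
  obtain ⟨m, c, ξ, hc, hξ, rfl⟩ := h
  simp only [map_sum, map_smul]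
  exact isStronglyPositive_sum _ fun i _ => ((hξ i).wedge g₀).smul (hc i)

/-! ### Strongly positive elements span the forms of even degree -/

/-- Each basis element `ω^J` is, up to sign, `ω^k ∧ ω^{J \ {k}}` for any `k ∈ J`. -/
lemma span_leftWedge (p : ℕ) :
    Submodule.span ℂ {ω : Ext n (p + 1) | ∃ k F, ω = leftWedge p (p + 1) k F} = ⊤ := by
  classical
  rw [eq_top_iff, ← (Pi.basisFun ℂ (MultiIndex n (p + 1))).span_eq, Submodule.span_le]
  rintro _ ⟨J, rfl⟩
  obtain ⟨k, hk⟩ : J.1.Nonempty := Finset.card_pos.1 (by rw [J.2]; omega)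
  have hJ : (J.1.erase k).card = p := by rw [Finset.card_erase_of_mem hk, J.2]; rfl
  have : Pi.single J 1 = ((-1 : ℂ) ^ (J.1.filter (· < k)).card) •
      leftWedge p (p + 1) k (Pi.single ⟨J.1.erase k, hJ⟩ 1) := by
    ext J'
    simp only [Pi.smul_apply, leftWedge_apply, smul_eq_mul]
    by_cases h : J' = J
    · subst h
      simp [hk, coeff, hJ, -Finset.card_erase_of_mem, ← mul_pow]
    · rw [Pi.single_eq_of_ne h]
      by_cases hk' : k ∈ J'.1
      · have hc : (J'.1.erase k).card = p := by rw [Finset.card_erase_of_mem hk', J'.2]; rfl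
        have hne : (⟨J'.1.erase k, hc⟩ : MultiIndex n p) ≠ ⟨J.1.erase k, hJ⟩ := by
          intro h'
          refine h (Subtype.ext ?_)
          rw [← Finset.insert_erase hk, ← Finset.insert_erase hk', Subtype.mk.inj h']
        rw [coeff, dif_pos hc, Pi.single_eq_of_ne hne]
        simp
      · simp [hk']
  rw [Pi.basisFun_apply, this]
  exact Submodule.smul_mem _ _ (Submodule.subset_span ⟨k, _, rfl⟩)

/-- The linear span of the strongly positive elements. -/
def spSpan (n p : ℕ) : Submodule ℂ (Ext n p) :=
  Submodule.span ℂ {ω | IsStronglyPositive ω}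

lemma vecWedge_rowVec_mem_spSpan {p : ℕ} {ω : Ext n p} (hω : ω ∈ spSpan n p)
    (g : Fin n → Quaternion ℝ) :
    vecWedge (p + 1) (p + 2) (rowVec g 0) (vecWedge p (p + 1) (rowVec g 1) ω) ∈
      spSpan n (p + 2) := by
  induction hω using Submodule.span_induction with
  | mem x hx => exact Submodule.subset_span (hx.wedge g)
  | zero => simp
  | add x y _ _ hx hy => simpa using Submodule.add_mem _ hx hy
  | smul c x _ hx => simpa using Submodule.smul_mem _ c hx

/-- Polarization of `vecWedge_rowVec_mem_spSpan`. -/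
lemma vecWedge_rowVec_rowVec_mem_spSpan {p : ℕ} {ω : Ext n p} (hω : ω ∈ spSpan n p)
    (g h : Fin n → Quaternion ℝ) :
    vecWedge (p + 1) (p + 2) (rowVec g 0) (vecWedge p (p + 1) (rowVec h 1) ω) ∈
      spSpan n (p + 2) := by
  have key (h : Fin n → Quaternion ℝ) :
      vecWedge (p + 1) (p + 2) (rowVec g 0) (vecWedge p (p + 1) (rowVec h 1) ω)
      + vecWedge (p + 1) (p + 2) (rowVec h 0) (vecWedge p (p + 1) (rowVec g 1) ω) ∈
        spSpan n (p + 2) := by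
    have h1 := vecWedge_rowVec_mem_spSpan hω (g + h)
    have h2 := vecWedge_rowVec_mem_spSpan hω g
    have h3 := vecWedge_rowVec_mem_spSpan hω h
    convert Submodule.sub_mem _ (Submodule.sub_mem _ h1 h2) h3 using 1
    simp only [rowVec_add, vecWedge_add_left, LinearMap.add_apply, map_add]
    abel
  have h1 := key h
  -- Write `a(g, h)` for the target. `key` gives `a(g, h) + a(h, g)`. Replacing `h` by `-i h`
  -- multiplies its two pull-backs by `I` and `-I`, which gives `-I a(g, h) + I a(h, g)`; combining
  -- the two isolates `a(g, h)`.
  have h2 := key ((quat 0 (-1) 0 0) • h)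
  have e0 : rowVec ((quat 0 (-1) 0 0) • h) 0 = Complex.I • rowVec h 0 := by
    rw [rowVec_smul]; simp [tau]
  have e1 : rowVec ((quat 0 (-1) 0 0) • h) 1 = (-Complex.I) • rowVec h 1 := by
    rw [rowVec_smul]; simp [tau]
  rw [e0, e1] at h2
  simp only [vecWedge_smul_left, LinearMap.smul_apply, map_smul] at h2
  have h3 := Submodule.smul_mem _ (1 / 2 : ℂ)
    (Submodule.add_mem _ h1 (Submodule.smul_mem _ Complex.I h2))
  convert h3 using 1
  simp only [smul_add, smul_smul]
  ring_nf
  simp only [Complex.I_sq]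
  module

lemma exists_rowVec_zero_eq_single (k : Fin (2 * n)) :
    ∃ g : Fin n → Quaternion ℝ, rowVec g 0 = Pi.single k 1 := by
  have hne (j : Fin (2 * n)) (h : j ≠ k) (h' : quatIndex j = quatIndex k) : parity j ≠ parity k := by
    simp only [ne_eq, Fin.ext_iff, quatIndex, parity] at *
    omega
  rcases fin_two_cases (parity k) with h | h
  · refine ⟨Pi.single (quatIndex k) (quat 1 0 0 0), ?_⟩
    ext j
    by_cases hj : j = k
    · subst hj; simp [rowVec, h, tau]
    · by_cases hq : quatIndex j = quatIndex k
      · have := hne j hj hq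
        have h1 : parity j = 1 := (fin_two_cases (parity j)).resolve_left (by rwa [h] at this)
        simp [rowVec, h1, hq, tau, hj]
      · simp [rowVec, hq, tau_zero, hj]
  -- The first row of `τ(-j)` is `(0, 1)`.
  · refine ⟨Pi.single (quatIndex k) (quat 0 0 (-1) 0), ?_⟩
    ext j
    by_cases hj : j = k
    · subst hj; simp [rowVec, h, tau]
    · by_cases hq : quatIndex j = quatIndex k
      · have := hne j hj hq
        have h1 : parity j = 0 := (fin_two_cases (parity j)).resolve_right (by rwa [h] at this)
        simp [rowVec, h1, hq, tau, hj]
      · simp [rowVec, hq, tau_zero, hj]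

lemma exists_rowVec_one_eq_single (k : Fin (2 * n)) :
    ∃ g : Fin n → Quaternion ℝ, rowVec g 1 = Pi.single k 1 := by
  obtain ⟨g, hg⟩ := exists_rowVec_zero_eq_single k
  -- Left multiplication by `j` moves the first row of `τ` to the second.
  refine ⟨(quat 0 0 1 0) • g, ?_⟩
  rw [rowVec_smul, hg]
  simp [tau]

lemma spSpan_zero : spSpan n 0 = ⊤ := by
  rw [eq_top_iff]
  intro F _
  have h1 : IsElementaryStronglyPositive (fun _ => 1 : Ext n 0) :=
    ⟨0, rfl, fun i => i.elim0, linearIndependent_empty_type, by ext; simp [wedgeVectors]⟩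
  have h2 : F = F ⟨∅, rfl⟩ • (fun _ => 1 : Ext n 0) := by
    ext ⟨I, hI⟩
    obtain rfl := Finset.card_eq_zero.1 hI
    simp
  rw [h2]
  exact Submodule.smul_mem _ _ (Submodule.subset_span h1.isStronglyPositive)

/-- Every coordinate vector occurs both as some `rowVec g 0` and as some `rowVec g' 1`, so the
polarized membership covers all `ω^j ∧ ω^k ∧ F`, and these span. -/
lemma spSpan_add_two {p : ℕ} (h : spSpan n p = ⊤) : spSpan n (p + 2) = ⊤ := by
  rw [eq_top_iff, ← span_leftWedge (n := n) (p + 1), Submodule.span_le]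
  rintro _ ⟨j, G, rfl⟩
  have hG : G ∈ Submodule.span ℂ {ω : Ext n (p + 1) | ∃ k F, ω = leftWedge p (p + 1) k F} := by
    rw [span_leftWedge]; trivial
  induction hG using Submodule.span_induction with
  | mem x hx =>
    obtain ⟨k, F, rfl⟩ := hx
    obtain ⟨g, hg⟩ := exists_rowVec_zero_eq_single j
    obtain ⟨g', hg'⟩ := exists_rowVec_one_eq_single k
    have := vecWedge_rowVec_rowVec_mem_spSpan (ω := F) (by rw [h]; trivial) g g'
    rw [hg, hg', vecWedge_single, vecWedge_single] at this
    exact this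
  | zero => simp
  | add x y _ _ hx hy => simpa using Submodule.add_mem _ hx hy
  | smul c x _ hx => simpa using Submodule.smul_mem _ c hx

lemma spSpan_even (r : ℕ) : spSpan n (2 * r) = ⊤ := by
  induction r with
  | zero => exact spSpan_zero
  | succ r ih => exact spSpan_add_two ih

/-! ### Positivity of the quaternionic Hessian -/

/-- The value of the complexified bilinear form `B` at the vectors `∇_{k0}`, `∇_{j1}`. -/
def hessCoeff (B : Hn n → Hn n → ℝ) (k j : Fin (2 * n)) : ℂ :=
  (B (dirRe k 0) (dirRe j 1) + Complex.I * B (dirRe k 0) (dirIm j 1))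
    + Complex.I * (B (dirIm k 0) (dirRe j 1) + Complex.I * B (dirIm k 0) (dirIm j 1))

/-- The basis `1, i, j, k` of the quaternions. -/
def quatBasis : Fin 4 → Quaternion ℝ :=
  ![quat 1 0 0 0, quat 0 1 0 0, quat 0 0 1 0, quat 0 0 0 1]

/-- The real coordinates of a quaternion. -/
def quatCoord (q : Quaternion ℝ) : Fin 4 → ℝ := ![q.re, q.imI, q.imJ, q.imK]

lemma sum_quatCoord (q : Quaternion ℝ) : q = ∑ a, quatCoord q a • quatBasis a := by
  ext <;> simp [Fin.sum_univ_four, quatCoord, quatBasis]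

/-- The map `x ↦ x e` of `ℍⁿ`. -/
def rightMul (e : Quaternion ℝ) : Hn n →L[ℝ] Hn n :=
  ContinuousLinearMap.pi fun l =>
    (ContinuousLinearMap.mul ℝ (Quaternion ℝ)).flip e ∘L ContinuousLinearMap.proj l

lemma rightMul_apply (e : Quaternion ℝ) (x : Hn n) (l : Fin n) : rightMul e x l = x l * e := rfl

lemma rightMul_single (e : Quaternion ℝ) (l : Fin n) (q : Quaternion ℝ) :
    rightMul e (Pi.single l q) = Pi.single l (q * e) := by
  ext m : 1
  by_cases h : m = l
  · subst h; simp [rightMul_apply]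
  · simp [rightMul_apply, h]

lemma bilin_single_expand (B : Hn n →L[ℝ] Hn n →L[ℝ] ℝ) (l m : Fin n) (p q : Quaternion ℝ) :
    B (Pi.single l p) (Pi.single m q) = ∑ a, ∑ b, quatCoord p a * quatCoord q b *
      B (Pi.single l (quatBasis a)) (Pi.single m (quatBasis b)) := by
  have hs (l : Fin n) (p : Quaternion ℝ) : (Pi.single l p : Hn n)
      = ∑ a, quatCoord p a • (Pi.single l (quatBasis a) : Hn n) := by
    conv_lhs => rw [sum_quatCoord p]
    simp only [← Pi.single_smul]
    exact map_sum (AddMonoidHom.single (fun _ : Fin n => Quaternion ℝ) l) _ _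
  rw [hs l p, hs m q]
  simp only [map_sum, map_smul, sum_apply, smul_apply, smul_eq_mul, Finset.mul_sum]
  rw [Finset.sum_comm]
  exact Finset.sum_congr rfl fun _ _ => Finset.sum_congr rfl fun _ _ => by ring

/-- The sum of the pull-backs of a bilinear form under the right multiplications by `1, i, j, k`. -/
def averagedForm (B : Hn n →L[ℝ] Hn n →L[ℝ] ℝ) : Hn n →L[ℝ] Hn n →L[ℝ] ℝ :=
  ∑ e, B.bilinearComp (rightMul (quatBasis e)) (rightMul (quatBasis e))

lemma averagedForm_apply (B : Hn n →L[ℝ] Hn n →L[ℝ] ℝ) (x y : Hn n) :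
    averagedForm B x y = ∑ e, B (rightMul (quatBasis e) x) (rightMul (quatBasis e) y) := by
  simp [averagedForm, sum_apply]

/-- By symmetry of `B` the difference is `B(∇_{k0}, ∇_{j1}) - B(∇_{k1}, ∇_{j0})`, a determinant in
the index `α`. Right multiplication by a unit quaternion acts on `α` by a matrix of determinant one,
so each of the four summands contributes the same. The proof checks this in coordinates. -/
lemma hessCoeff_averagedForm (B : Hn n →L[ℝ] Hn n →L[ℝ] ℝ) (hB : ∀ x y, B x y = B y x)
    (k j : Fin (2 * n)) :
    hessCoeff (fun x y => averagedForm B x y) k j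
        - hessCoeff (fun x y => averagedForm B x y) j k =
      4 * (hessCoeff (fun x y => B x y) k j - hessCoeff (fun x y => B x y) j k) := by
  have hB' (x y) : averagedForm B x y = averagedForm B y x := by
    simp only [averagedForm_apply, hB (rightMul _ x)]
  -- Swapping the arguments puts block `k` first and block `j` second in every term, so that one
  -- coefficient array `β` describes them all.
  have e1 (B : Hn n → Hn n → ℝ) (hB : ∀ x y, B x y = B y x) : hessCoeff B j k =
    (B (dirRe k 1) (dirRe j 0) + Complex.I * B (dirIm k 1) (dirRe j 0))
      + Complex.I * (B (dirRe k 1) (dirIm j 0) + Complex.I * B (dirIm k 1) (dirIm j 0)) := by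
    rw [hessCoeff, hB (dirRe j 0), hB (dirRe j 0), hB (dirIm j 0), hB (dirIm j 0)]
  rw [e1 _ hB', e1 _ hB]
  obtain ⟨β, hβ⟩ : ∃ β : Fin 4 → Fin 4 → ℝ, ∀ p q, B (Pi.single (quatIndex k) p)
      (Pi.single (quatIndex j) q) = ∑ a, ∑ b, quatCoord p a * quatCoord q b * β a b :=
    ⟨_, bilin_single_expand B _ _⟩
  rcases fin_two_cases (parity k) with h | h <;> rcases fin_two_cases (parity j) with h' | h' <;>
  · simp only [hessCoeff, averagedForm_apply, dirRe, dirIm, h, h', rightMul_single, hβ]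
    simp [Fin.sum_univ_four, quatCoord, quatBasis]
    ring_nf
    try simp
    try ring

/-- The Gram matrix of `B` in the real basis of `ℍⁿ` is positive semidefinite, hence of the form `Nᵀ
N`; the rows of `N` are the functionals. -/
lemma exists_sq_sum_of_nonneg (B : Hn n →L[ℝ] Hn n →L[ℝ] ℝ) (hB : ∀ x y, B x y = B y x)
    (hpos : ∀ x, 0 ≤ B x x) :
    ∃ N : Fin n × Fin 4 → Fin n × Fin 4 → ℝ, ∀ l p m q,
      B (Pi.single l p) (Pi.single m q) =
        ∑ i, (∑ a, quatCoord p a * N i (l, a)) * ∑ b, quatCoord q b * N i (m, b) := by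
  open scoped MatrixOrder in
  set M : Matrix (Fin n × Fin 4) (Fin n × Fin 4) ℝ := Matrix.of fun s t =>
    B (Pi.single s.1 (quatBasis s.2)) (Pi.single t.1 (quatBasis t.2)) with hM
  have hpsd : M.PosSemidef := by
    refine .of_dotProduct_mulVec_nonneg ?_ fun x => ?_
    · ext s t
      simp [hM, hB (Pi.single s.1 _)]
    · have := hpos (∑ s, x s • (Pi.single s.1 (quatBasis s.2) : Hn n))
      simp only [map_sum, map_smul, sum_apply, smul_apply, smul_eq_mul, Finset.mul_sum] at this
      refine this.trans_eq ?_
      rw [Finset.sum_comm]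
      simp only [dotProduct, Matrix.mulVec, hM, Matrix.of_apply, star_trivial, Finset.mul_sum]
      exact Finset.sum_congr rfl fun _ _ => Finset.sum_congr rfl fun _ _ => by ring
  obtain ⟨N, hN⟩ := CStarAlgebra.nonneg_iff_eq_star_mul_self.mp hpsd.nonneg
  refine ⟨N, fun l p m q => ?_⟩
  have hent (l a m b) : B (Pi.single l (quatBasis a)) (Pi.single m (quatBasis b))
      = ∑ i, N i (l, a) * N i (m, b) := by
    have := congrFun (congrFun hN (l, a)) (m, b)
    simpa [hM, Matrix.mul_apply] using this
  rw [bilin_single_expand]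
  simp only [hent, Finset.sum_mul_sum]
  rw [Finset.sum_comm (s := (Finset.univ : Finset (Fin n × Fin 4)))]
  refine Finset.sum_congr rfl fun a _ => ?_
  rw [Finset.sum_comm (s := (Finset.univ : Finset (Fin n × Fin 4)))]
  refine Finset.sum_congr rfl fun b _ => ?_
  rw [Finset.mul_sum]
  exact Finset.sum_congr rfl fun i _ => by ring

/-- A nonnegative symmetric form is a sum of squares of real parts of right `ℍ`-linear maps. -/
lemma exists_rowVec_of_nonneg (B : Hn n →L[ℝ] Hn n →L[ℝ] ℝ) (hB : ∀ x y, B x y = B y x)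
    (hpos : ∀ x, 0 ≤ B x x) :
    ∃ g : Fin n × Fin 4 → Fin n → Quaternion ℝ, ∀ k j,
      hessCoeff (fun x y => B x y) k j = ∑ i, rowVec (g i) 0 k * rowVec (g i) 1 j := by
  obtain ⟨N, hN⟩ := exists_sq_sum_of_nonneg B hB hpos
  -- The signs are those for which the real part of `∑ g_l q_l` is the functional with coefficients
  -- `N i`.
  refine ⟨fun i l => quat (N i (l, 0)) (-N i (l, 1)) (-N i (l, 2)) (-N i (l, 3)), fun k j => ?_⟩
  simp only [hessCoeff, dirRe, dirIm, hN, Complex.ofReal_sum, Finset.mul_sum,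
    ← Finset.sum_add_distrib]
  refine Finset.sum_congr rfl fun i _ => ?_
  rcases fin_two_cases (parity k) with h | h <;> rcases fin_two_cases (parity j) with h' | h' <;>
  · simp [h, h', rowVec, tau, Fin.sum_univ_four, quatCoord]
    ring

/-- Since `ω^k ∧ ω^j` is antisymmetric, the symmetric part of a coefficient matrix drops out. -/
lemma sum_leftWedge_antisymm {p : ℕ} (C : Fin (2 * n) → Fin (2 * n) → ℂ) (ξ : Ext n p) :
    ∑ k, ∑ j, (C k j - C j k) • leftWedge (p + 1) (p + 2) k (leftWedge p (p + 1) j ξ) =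
      (2 : ℂ) • ∑ k, ∑ j, C k j • leftWedge (p + 1) (p + 2) k (leftWedge p (p + 1) j ξ) := by
  simp only [sub_smul, Finset.sum_sub_distrib, two_smul]
  rw [sub_eq_add_neg]
  congr 1
  rw [Finset.sum_comm, ← Finset.sum_neg_distrib]
  refine Finset.sum_congr rfl fun k _ => ?_
  rw [← Finset.sum_neg_distrib]
  refine Finset.sum_congr rfl fun j _ => ?_
  rw [leftWedge_anticomm j k, smul_neg, neg_neg]

/-- Exterior multiplication by the quaternionic Hessian of a form which is nonnegative in the mean
over right quaternionic lines preserves strong positivity. -/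
theorem isStronglyPositive_hess_wedge {p : ℕ} (B : Hn n →L[ℝ] Hn n →L[ℝ] ℝ)
    (hB : ∀ x y, B x y = B y x)
    (hpos : ∀ x, 0 ≤ ∑ e, B (rightMul (quatBasis e) x) (rightMul (quatBasis e) x))
    {ξ : Ext n p} (hξ : IsStronglyPositive ξ) :
    IsStronglyPositive (∑ k, ∑ j, hessCoeff (fun x y => B x y) k j •
      leftWedge (p + 1) (p + 2) k (leftWedge p (p + 1) j ξ)) := by
  have hB' (x y) : averagedForm B x y = averagedForm B y x := by
    simp only [averagedForm_apply, hB (rightMul _ x)]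
  obtain ⟨g, hg⟩ := exists_rowVec_of_nonneg (averagedForm B) hB'
    (fun x => by rw [averagedForm_apply]; exact hpos x)
  have h1 := sum_leftWedge_antisymm (hessCoeff (fun x y => B x y)) ξ
  have h2 := sum_leftWedge_antisymm (hessCoeff (fun x y => averagedForm B x y)) ξ
  -- With `S` and `S'` the sums for `B` and its averaged form, the two identities combine to `8 S =
  -- 2 S'`, so `S = S' / 4`.
  simp only [hessCoeff_averagedForm B hB, mul_smul, ← Finset.smul_sum] at h2
  rw [h1] at h2
  have h3 : ∑ k, ∑ j, hessCoeff (fun x y => B x y) k j •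
      leftWedge (p + 1) (p + 2) k (leftWedge p (p + 1) j ξ) =
      ((1 / 4 : ℝ) : ℂ) • ∑ i, vecWedge (p + 1) (p + 2) (rowVec (g i) 0)
        (vecWedge p (p + 1) (rowVec (g i) 1) ξ) := by
    have h4 : ∑ k, ∑ j, hessCoeff (fun x y => averagedForm B x y) k j •
        leftWedge (p + 1) (p + 2) k (leftWedge p (p + 1) j ξ) =
        ∑ i, vecWedge (p + 1) (p + 2) (rowVec (g i) 0)
          (vecWedge p (p + 1) (rowVec (g i) 1) ξ) := by
      simp only [hg, vecWedge_apply, map_sum, map_smul, Finset.smul_sum, Finset.sum_smul, smul_smul]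
      rw [Finset.sum_comm, Finset.sum_comm (s := (Finset.univ : Finset (Fin n × Fin 4)))]
      refine Finset.sum_congr rfl fun k _ => ?_
      rw [Finset.sum_comm]
      simp only [mul_comm]
    rw [← h4]
    have h5 := congrArg (fun z => (1 / 8 : ℂ) • z) h2
    simp only [smul_smul] at h5
    norm_num at h5
    simpa using h5
  rw [h3]
  exact (isStronglyPositive_sum _ fun i _ => hξ.wedge (g i)).smul (by norm_num)

end QuatPluripotential

end

noncomputable section

namespace QuatPluripotential

open scoped ContDiff

variable {n : ℕ} {Ω : TopologicalSpace.Opens (Hn n)}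

/-! ### The operators `d_α` on test forms -/

/-- A smooth form that vanishes wherever the test form `φ` does, as a test form. -/
def testFormOf {p p' : ℕ} (φ : TestForm Ω p) (f : Hn n → Ext n p') (hf : ContDiff ℝ ∞ f)
    (h : ∀ x, φ x = 0 → f x = 0) : TestForm Ω p' :=
  have hs : tsupport f ⊆ tsupport φ :=
    closure_mono fun x hx hφ => hx (h x hφ)
  ⟨f, hf, φ.hasCompactSupport.mono' (subset_closure.trans hs), hs.trans φ.tsupport_subset⟩

lemma TestForm.differentiable {p : ℕ} (φ : TestForm Ω p) : Differentiable ℝ φ :=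
  φ.contDiff.differentiable (by simp)

lemma contDiff_leftWedge_comp {p p' : ℕ} (k : Fin (2 * n)) {f : Hn n → Ext n p}
    (hf : ContDiff ℝ ∞ f) : ContDiff ℝ ∞ (fun x => leftWedge p p' k (f x)) :=
  ((leftWedge p p' k).restrictScalars ℝ).contDiff.comp hf

lemma dFun_dFun {p₁ p₂ p₃ : ℕ} (α β : Fin 2) {f : Hn n → Ext n p₁} (hf : ContDiff ℝ ∞ f)
    (x : Hn n) : dFun p₂ p₃ α (dFun p₁ p₂ β f) x =
      ∑ k, ∑ j, leftWedge p₂ p₃ k (leftWedge p₁ p₂ j (nablaFun k α (nablaFun j β f) x)) := by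
  have hd (j : Fin (2 * n)) : Differentiable ℝ (nablaFun j β f) :=
    (contDiff_nablaFun j β hf).differentiable (by simp)
  have hd' (j : Fin (2 * n)) : Differentiable ℝ (fun x => leftWedge p₁ p₂ j (nablaFun j β f x)) :=
    (contDiff_leftWedge_comp j (contDiff_nablaFun j β hf)).differentiable (by simp)
  rw [dFun]
  refine Finset.sum_congr rfl fun k _ => ?_
  have : nablaFun k α (dFun p₁ p₂ β f) x
      = ∑ j, leftWedge p₁ p₂ j (nablaFun k α (nablaFun j β f) x) := by
    refine (nablaFun_sum Finset.univ k α (fun j _ => hd' j) x).trans ?_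
    exact Finset.sum_congr rfl fun j _ => nablaFun_clm_comp k α _ (hd j) x
  rw [this, map_sum]

/-- The derivatives commute and the exterior factors anticommute, so exchanging the two summation
indices costs one sign. -/
lemma dForm_anticomm {p₁ p₂ p₃ : ℕ} (α β : Fin 2) (φ : TestForm Ω p₁) :
    dForm p₂ p₃ α (dForm p₁ p₂ β φ) = - dForm p₂ p₃ β (dForm p₁ p₂ α φ) := by
  ext1 x
  change _ = - (dForm p₂ p₃ β (dForm p₁ p₂ α φ) x)
  rw [dForm_apply, dForm_apply, coe_dForm, coe_dForm, dFun_dFun _ _ φ.contDiff,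
    dFun_dFun _ _ φ.contDiff, Finset.sum_comm, ← Finset.sum_neg_distrib]
  refine Finset.sum_congr rfl fun k _ => ?_
  rw [← Finset.sum_neg_distrib]
  refine Finset.sum_congr rfl fun j _ => ?_
  rw [leftWedge_anticomm, nablaFun_comm _ _ _ _ φ.contDiff]

lemma dForm_dForm_self {p₁ p₂ p₃ : ℕ} (α : Fin 2) (φ : TestForm Ω p₁) :
    dForm p₂ p₃ α (dForm p₁ p₂ α φ) = 0 := by
  ext1 x
  exact self_eq_neg.1 (congrArg (fun ψ : TestForm Ω p₃ => ψ x) (dForm_anticomm α α φ))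

/-- The current `△F` is closed. -/
lemma Current.isClosed_laplace {p : ℕ} (F : Current Ω p) : F.laplace.IsClosed := by
  intro α
  ext φ
  rcases fin_two_cases α with rfl | rfl
  · simp only [Current.d, Current.laplace, ContinuousLinearMap.comp_apply, neg_apply]
    rw [dForm_anticomm 1 0, map_neg, dForm_dForm_self]
    simp
  · simp only [Current.d, Current.laplace, ContinuousLinearMap.comp_apply, neg_apply]
    rw [dForm_dForm_self]
    simp

/-- Needed in top degree, where truncated subtraction produces two equal degrees of test forms. -/
lemma dForm_eq_zero {p p' : ℕ} (h : p' ≠ p + 1) (α : Fin 2) :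
    (dForm p p' α : TestForm Ω p →L[ℂ] TestForm Ω p') = 0 := by
  ext1 φ
  ext1 x
  rw [dForm_apply, dFun]
  simp [leftWedge_eq_zero h]

/-- Integration by parts against a closed current: `T(v △η) = T(△v ∧ η)`. -/
theorem closed_apply_smul_laplace {m : ℕ} (T : TestForm Ω (m + 2) →L[ℂ] ℂ)
    (hT : ∀ α ψ, T (dForm (m + 1) (m + 2) α ψ) = 0) {v : Hn n → ℂ} (hv : ContDiff ℝ ∞ v)
    (η : TestForm Ω m) (A Θ : TestForm Ω (m + 2))
    (hA : ∀ x, A x = v x • dForm (m + 1) (m + 2) 0 (dForm m (m + 1) 1 η) x)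
    (hΘ : ∀ x, Θ x = ∑ k, ∑ j, nablaFun k 0 (nablaFun j 1 v) x •
      leftWedge (m + 1) (m + 2) k (leftWedge m (m + 1) j (η x))) :
    T A = T Θ := by
  have hvd : Differentiable ℝ v := hv.differentiable (by simp)
  have hnv (j : Fin (2 * n)) (α : Fin 2) : ContDiff ℝ ∞ (nablaFun j α v) :=
    contDiff_nablaFun j α hv
  -- The forms `ψ₁ = v d₁η` and `ψ₂ = d₀v ∧ η`. In `d₀ψ₁ + d₁ψ₂` the mixed terms `d₀v ∧ d₁η` cancel,
  -- leaving `v △η - △v ∧ η`, and the closed `T` kills both exact forms.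
  let ψ₁ : TestForm Ω (m + 1) := testFormOf (dForm m (m + 1) 1 η)
    (fun x => v x • dForm m (m + 1) 1 η x)
    (hv.smul (dForm m (m + 1) 1 η).contDiff) (fun x hx => by simp [hx])
  let ψ₂ : TestForm Ω (m + 1) := testFormOf η
    (fun x => ∑ k, nablaFun k 0 v x • leftWedge m (m + 1) k (η x))
    (ContDiff.sum fun k _ => (hnv k 0).smul (contDiff_leftWedge_comp k η.contDiff))
    (fun x hx => by simp [hx])
  have h1 (x : Hn n) : dForm (m + 1) (m + 2) 0 ψ₁ x = A x
      + ∑ k, nablaFun k 0 v x • leftWedge (m + 1) (m + 2) k (dForm m (m + 1) 1 η x) := by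
    rw [hA, dForm_apply, dForm_apply, dFun, dFun, Finset.smul_sum, ← Finset.sum_add_distrib]
    refine Finset.sum_congr rfl fun k _ => ?_
    have := nablaFun_smul k 0 hvd (TestForm.differentiable (dForm m (m + 1) 1 η)) x
    change leftWedge _ _ k (nablaFun k 0 (fun x => v x • dForm m (m + 1) 1 η x) x) = _
    rw [this, map_add, map_smul, map_smul]
  have h2 (x : Hn n) : dForm (m + 1) (m + 2) 1 ψ₂ x = - Θ x
      - ∑ k, nablaFun k 0 v x • leftWedge (m + 1) (m + 2) k (dForm m (m + 1) 1 η x) := by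
    have hk (j k : Fin (2 * n)) :
        nablaFun j 1 (fun x => nablaFun k 0 v x • leftWedge m (m + 1) k (η x)) x =
          nablaFun k 0 v x • leftWedge m (m + 1) k (nablaFun j 1 η x)
          + nablaFun j 1 (nablaFun k 0 v) x • leftWedge m (m + 1) k (η x) := by
      rw [nablaFun_smul j 1 ((hnv k 0).differentiable (by simp))
        ((contDiff_leftWedge_comp k η.contDiff).differentiable (by simp)),
        nablaFun_clm_comp j 1 _ η.differentiable]
    have hs (j : Fin (2 * n)) : nablaFun j 1 ψ₂ x =
        ∑ k, (nablaFun k 0 v x • leftWedge m (m + 1) k (nablaFun j 1 η x)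
          + nablaFun j 1 (nablaFun k 0 v) x • leftWedge m (m + 1) k (η x)) := by
      refine (nablaFun_sum Finset.univ j 1 (fun k _ => ?_) x).trans
        (Finset.sum_congr rfl fun k _ => hk j k)
      exact ((hnv k 0).smul (contDiff_leftWedge_comp k η.contDiff)).differentiable (by simp)
    rw [dForm_apply, dFun, hΘ]
    simp only [hs, dForm_apply, dFun, map_sum, map_add, map_smul, Finset.smul_sum,
      Finset.sum_add_distrib]
    refine (add_comm _ _).trans ?_
    rw [sub_eq_add_neg]
    congr 1
    · rw [Finset.sum_comm, ← Finset.sum_neg_distrib]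
      refine Finset.sum_congr rfl fun k _ => ?_
      rw [← Finset.sum_neg_distrib]
      refine Finset.sum_congr rfl fun j _ => ?_
      rw [leftWedge_anticomm j k, smul_neg, nablaFun_comm _ _ _ _ hv]
    · rw [Finset.sum_comm, ← Finset.sum_neg_distrib]
      refine Finset.sum_congr rfl fun k _ => ?_
      rw [← Finset.sum_neg_distrib]
      refine Finset.sum_congr rfl fun j _ => ?_
      rw [leftWedge_anticomm j k, smul_neg]
  have h3 : dForm (m + 1) (m + 2) 0 ψ₁ + dForm (m + 1) (m + 2) 1 ψ₂ = A - Θ := by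
    ext1 x
    change dForm (m + 1) (m + 2) 0 ψ₁ x + dForm (m + 1) (m + 2) 1 ψ₂ x = A x - Θ x
    rw [h1, h2]
    abel
  have h4 := congrArg T h3
  rw [map_add, hT, hT, map_sub, add_zero] at h4
  exact sub_eq_zero.1 h4.symm

end QuatPluripotential

end

noncomputable section

namespace QuatPluripotential

open scoped ContDiff ENNReal
open MeasureTheory

variable {n : ℕ}

/-! ### Mollification -/

/-- An inequality for means over balls implies the one for means with radially decreasing
weights. -/
lemma lintegral_radial_mul_le {f : Quaternion ℝ → ℝ≥0∞} (hf : Measurable f) {C : ℝ≥0∞} {ε : ℝ}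
    {ρ : Quaternion ℝ → ℝ} (hρ : Continuous ρ) (hρ0 : ∀ ξ, 0 ≤ ρ ξ)
    (hρr : ∀ ξ ζ, ‖ξ‖ ≤ ‖ζ‖ → ρ ζ ≤ ρ ξ) (hρs : ∀ ξ, ε < ‖ξ‖ → ρ ξ = 0)
    (h : ∀ r, 0 < r → r ≤ ε → ∫⁻ ξ in Metric.closedBall 0 r, f ξ ≤
      volume (Metric.closedBall (0 : Quaternion ℝ) r) * C) :
    ∫⁻ ξ, ENNReal.ofReal (ρ ξ) * f ξ ≤ (∫⁻ ξ, ENNReal.ofReal (ρ ξ)) * C := by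
  -- Layer cake: for `t > 0` a nonempty superlevel set of `ρ` is a closed ball about 0 of radius at
  -- most `ε`, to which `h` applies. Its radius is the largest norm attained in it; radius 0 gives a
  -- null set.
  have hle (t : ℝ) (ht : 0 < t) :
      volume.withDensity f {ξ | t ≤ ρ ξ} ≤ volume {ξ | t ≤ ρ ξ} * C := by
    have hcl : IsClosed {ξ | t ≤ ρ ξ} := isClosed_le continuous_const hρ
    have hsub : {ξ | t ≤ ρ ξ} ⊆ Metric.closedBall 0 ε := by
      intro ξ hξ
      by_contra hne
      have : ρ ξ = 0 := hρs ξ (by simpa using hne)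
      exact ht.not_ge (this ▸ hξ)
    rcases Set.eq_empty_or_nonempty {ξ | t ≤ ρ ξ} with he | hne
    · simp [he]
    obtain ⟨ξ₀, hξ₀, hmax⟩ := ((isCompact_closedBall (0 : Quaternion ℝ) ε).of_isClosed_subset
      hcl hsub).exists_isMaxOn hne continuous_norm.continuousOn
    have heq : {ξ | t ≤ ρ ξ} = Metric.closedBall 0 ‖ξ₀‖ := by
      ext ξ
      rw [mem_closedBall_zero_iff]
      exact ⟨fun hξ => hmax hξ, fun hξ => le_trans hξ₀ (hρr _ _ hξ)⟩
    rw [heq, withDensity_apply _ measurableSet_closedBall]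
    rcases (norm_nonneg ξ₀).eq_or_lt with h0 | hpos
    · rw [← h0, Metric.closedBall_zero]
      simp
    · exact h _ hpos (by simpa using hsub hξ₀)
  have hm : Measurable fun ξ => ENNReal.ofReal (ρ ξ) := hρ.measurable.ennreal_ofReal
  have h1 : ∫⁻ ξ, ENNReal.ofReal (ρ ξ) * f ξ = ∫⁻ ξ, ENNReal.ofReal (ρ ξ) ∂volume.withDensity f := by
    rw [lintegral_withDensity_eq_lintegral_mul _ hf hm]
    simp [mul_comm]
  rw [h1, lintegral_eq_lintegral_meas_le _ (.of_forall hρ0) hρ.aemeasurable,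
    lintegral_eq_lintegral_meas_le _ (.of_forall hρ0) hρ.aemeasurable, ← lintegral_mul_const]
  · exact setLIntegral_mono' measurableSet_Ioi fun t ht => hle t ht
  · exact Antitone.measurable fun s t hst => measure_mono fun ξ hξ => le_trans hst hξ

/-- Iteration of a mean value inequality over the coordinates. -/
lemma lmarginal_prod_mul_le {w : Quaternion ℝ → ℝ≥0∞} (hw : Measurable w) (hw1 : ∫⁻ ξ, w ξ ≤ 1)
    (s : Finset (Fin n)) {f : Hn n → ℝ≥0∞} (hf : Measurable f)
    (h : ∀ x i, ∫⁻ ξ, w ξ * f (Function.update x i ξ) ≤ f (Function.update x i 0)) (x : Hn n) :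
    (∫⋯∫⁻_s, (fun y => (∏ l ∈ s, w (y l)) * f y) ∂fun _ => volume) x ≤
      f (fun l => if l ∈ s then 0 else x l) := by
  -- Integrating out the coordinate `i` replaces `f` by its value with that coordinate set to 0, so
  -- `f` has to vary in the induction.
  induction s using Finset.induction_on generalizing f x with
  | empty => simp
  | insert i s hi ih =>
    have hm (s : Finset (Fin n)) : Measurable fun y : Hn n => ∏ l ∈ s, w (y l) :=
      Finset.measurable_prod _ fun l _ => hw.comp (measurable_pi_apply l)
    rw [lmarginal_insert' (fun y => (∏ l ∈ insert i s, w (y l)) * f y) ((hm _).mul hf) hi]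
    have hup : Measurable fun y : Hn n => Function.update y i (0 : Quaternion ℝ) :=
      measurable_pi_lambda _ fun l => by
        by_cases hl : l = i
        · subst hl; simp
        · simpa [hl] using measurable_pi_apply l
    have hf' : Measurable fun y : Hn n => f (Function.update y i 0) := hf.comp hup
    have hle : (fun y => ∫⁻ ξ, (∏ l ∈ insert i s, w (Function.update y i ξ l))
        * f (Function.update y i ξ)) ≤
        fun y => (∏ l ∈ s, w (y l)) * f (Function.update y i 0) := by
      intro y
      have hprod (ξ : Quaternion ℝ) : ∏ l ∈ insert i s, w (Function.update y i ξ l)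
          = (∏ l ∈ s, w (y l)) * w ξ := by
        rw [Finset.prod_insert hi, Function.update_self, mul_comm]
        congr 1
        exact Finset.prod_congr rfl fun l hl => by
          rw [Function.update_of_ne (ne_of_mem_of_not_mem hl hi)]
      simp only [hprod, mul_assoc]
      rw [lintegral_const_mul]
      · exact mul_le_mul_right (h y i) _
      · exact hw.mul (hf.comp (measurable_update y))
    refine (lmarginal_mono hle x).trans ((ih hf' ?_ x).trans_eq ?_)
    · intro y j
      -- The new function is constant in the coordinate `i`; there the inequality only needs total
      -- weight at most 1.
      by_cases hj : j = i
      · subst hj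
        simp only [Function.update_idem]
        rw [lintegral_mul_const _ hw]
        exact mul_le_of_le_one_left' hw1
      · simp only [Function.update_comm hj]
        exact h _ j
    · congr 1
      ext1 l
      by_cases hl : l = i
      · subst hl; simp
      · simp [hl]

/-! ### The product mollifier -/

/-- The radial weight on `ℍ` with support in the ball of radius `ε`. -/
def bump (ε : ℝ) (ξ : Quaternion ℝ) : ℝ := expNegInvGlue (ε ^ 2 - ‖ξ‖ ^ 2)

lemma contDiff_bump (ε : ℝ) : ContDiff ℝ ∞ (bump ε) :=
  expNegInvGlue.contDiff.comp (contDiff_const.sub (contDiff_norm_sq ℝ))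

lemma bump_nonneg (ε : ℝ) (ξ : Quaternion ℝ) : 0 ≤ bump ε ξ := expNegInvGlue.nonneg _

lemma bump_eq_zero {ε : ℝ} (hε : 0 < ε) {ξ : Quaternion ℝ} (h : ε < ‖ξ‖) : bump ε ξ = 0 :=
  expNegInvGlue.zero_of_nonpos (by nlinarith)

lemma bump_anti (ε : ℝ) {ξ ζ : Quaternion ℝ} (h : ‖ξ‖ ≤ ‖ζ‖) : bump ε ζ ≤ bump ε ξ :=
  expNegInvGlue.monotone (by gcongr)

lemma hasCompactSupport_bump {ε : ℝ} (hε : 0 < ε) : HasCompactSupport (bump ε) :=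
  HasCompactSupport.of_support_subset_isCompact (isCompact_closedBall 0 ε) fun ξ hξ => by
    by_contra h
    exact hξ (bump_eq_zero hε (by simpa using h))

lemma integrable_bump {ε : ℝ} (hε : 0 < ε) : Integrable (bump ε) :=
  (contDiff_bump ε).continuous.integrable_of_hasCompactSupport (hasCompactSupport_bump hε)

lemma integral_bump_pos {ε : ℝ} (hε : 0 < ε) : 0 < ∫ ξ, bump ε ξ :=
  (contDiff_bump ε).continuous.integral_pos_of_hasCompactSupport_nonneg_nonzero
    (hasCompactSupport_bump hε) (bump_nonneg ε)
    (x := 0) (expNegInvGlue.pos_of_pos (by simp; positivity)).ne'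

/-- The radial weight on `ℍ`, normalized to have integral `1`. -/
def mollifierQ (ε : ℝ) (ξ : Quaternion ℝ) : ℝ := (∫ ζ, bump ε ζ)⁻¹ * bump ε ξ

/-- The product mollifier on `ℍⁿ`. -/
def mollifier (n : ℕ) (ε : ℝ) (y : Hn n) : ℝ := ∏ l, mollifierQ ε (y l)

lemma mollifierQ_nonneg (ε : ℝ) (ξ : Quaternion ℝ) : 0 ≤ mollifierQ ε ξ :=
  mul_nonneg (inv_nonneg.2 (integral_nonneg (bump_nonneg ε))) (bump_nonneg ε ξ)

lemma mollifierQ_eq_zero {ε : ℝ} (hε : 0 < ε) {ξ : Quaternion ℝ} (h : ε < ‖ξ‖) :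
    mollifierQ ε ξ = 0 := by
  simp [mollifierQ, bump_eq_zero hε h]

lemma contDiff_mollifierQ (ε : ℝ) : ContDiff ℝ ∞ (mollifierQ ε) :=
  contDiff_const.mul (contDiff_bump ε)

lemma integrable_mollifierQ {ε : ℝ} (hε : 0 < ε) : Integrable (mollifierQ ε) :=
  (integrable_bump hε).const_mul _

lemma integral_mollifierQ {ε : ℝ} (hε : 0 < ε) : ∫ ξ, mollifierQ ε ξ = 1 := by
  simp only [mollifierQ]
  rw [integral_const_mul, inv_mul_cancel₀ (integral_bump_pos hε).ne']

lemma lintegral_mollifierQ {ε : ℝ} (hε : 0 < ε) :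
    ∫⁻ ξ, ENNReal.ofReal (mollifierQ ε ξ) = 1 := by
  rw [← ofReal_integral_eq_lintegral_ofReal (integrable_mollifierQ hε)
    (.of_forall (mollifierQ_nonneg ε)), integral_mollifierQ hε, ENNReal.ofReal_one]

lemma mollifier_nonneg (ε : ℝ) (y : Hn n) : 0 ≤ mollifier n ε y :=
  Finset.prod_nonneg fun l _ => mollifierQ_nonneg ε (y l)

lemma mollifier_eq_zero {ε : ℝ} (hε : 0 < ε) {y : Hn n} (h : ε < ‖y‖) : mollifier n ε y = 0 := by
  obtain ⟨l, hl⟩ : ∃ l, ε < ‖y l‖ := by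
    by_contra! hcon
    exact absurd ((pi_norm_le_iff_of_nonneg hε.le).2 hcon) (not_le.2 h)
  exact Finset.prod_eq_zero (Finset.mem_univ l) (mollifierQ_eq_zero hε hl)

lemma contDiff_mollifier (ε : ℝ) : ContDiff ℝ ∞ (mollifier n ε) :=
  contDiff_prod fun l _ => (contDiff_mollifierQ ε).comp (contDiff_apply ℝ (Quaternion ℝ) l)

lemma hasCompactSupport_mollifier {ε : ℝ} (hε : 0 < ε) : HasCompactSupport (mollifier n ε) :=
  HasCompactSupport.of_support_subset_isCompact (isCompact_closedBall 0 ε) fun ξ hξ => by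
    by_contra h
    exact hξ (mollifier_eq_zero hε (by simpa using h))

lemma integral_mollifier {ε : ℝ} (hε : 0 < ε) : ∫ y, mollifier n ε y = 1 := by
  simp only [mollifier]
  rw [integral_fintype_prod_volume_eq_pow]
  simp [integral_mollifierQ hε]

lemma integrable_mollifier {ε : ℝ} (hε : 0 < ε) : Integrable (mollifier n ε) :=
  (contDiff_mollifier ε).continuous.integrable_of_hasCompactSupport (hasCompactSupport_mollifier hε)

/-- The map `ξ ↦ w ξ` onto the right quaternionic line spanned by `w`. -/
def lineMap (w : Hn n) : Quaternion ℝ →L[ℝ] Hn n :=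
  ContinuousLinearMap.pi fun l => ContinuousLinearMap.mul ℝ (Quaternion ℝ) (w l)

lemma lineMap_apply (w : Hn n) (ξ : Quaternion ℝ) (l : Fin n) : lineMap w ξ l = w l * ξ := rfl

lemma norm_lineMap_le (w : Hn n) (ξ : Quaternion ℝ) : ‖lineMap w ξ‖ ≤ ‖w‖ * ‖ξ‖ := by
  refine (pi_norm_le_iff_of_nonneg (by positivity)).2 fun l => ?_
  rw [lineMap_apply, norm_mul]
  gcongr
  exact norm_le_pi_norm w l

/-! ### Mollification of functions with the mean value inequality -/

/-- A bounded integrable function on `ℍⁿ` that satisfies the mean value inequality on the balls in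
right quaternionic lines that are contained in `D`. -/
structure IsSubmean (U : Hn n → ℝ) (D : Set (Hn n)) (M : ℝ) : Prop where
  measurable : Measurable U
  abs_le_bound : ∀ x, |U x| ≤ M
  integrable : Integrable U
  submean : ∀ x w r, 0 < r → (∀ ξ ∈ Metric.closedBall 0 r, x + lineMap w ξ ∈ D) →
    ∫⁻ ξ in Metric.closedBall 0 r, ENNReal.ofReal (M - U (x + lineMap w ξ)) ≤
      volume (Metric.closedBall (0 : Quaternion ℝ) r) * ENNReal.ofReal (M - U x)

/-- The convolution of `U` with the product mollifier. -/
def mollify (U : Hn n → ℝ) (ε : ℝ) (x : Hn n) : ℝ := ∫ y, mollifier n ε y * U (x - y)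

namespace IsSubmean

variable {U : Hn n → ℝ} {D : Set (Hn n)} {M : ℝ}

lemma integrableOn_line (hU : IsSubmean U D M) (x w : Hn n) (r : ℝ) :
    IntegrableOn (fun ξ => U (x + lineMap w ξ)) (Metric.closedBall 0 r) := by
  refine Measure.integrableOn_of_bounded (M := M) ?_ ?_ (.of_forall fun ξ => hU.abs_le_bound _)
  · exact (isCompact_closedBall _ _).measure_ne_top
  · exact (hU.measurable.comp (by fun_prop)).aestronglyMeasurable

/-- For bounded functions the inequality between lower integrals of `M - U` can be rewritten with
Bochner integrals, and `M` cancels. -/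
lemma setIntegral_nonneg (hU : IsSubmean U D M) {x w : Hn n} {r : ℝ} (hr : 0 < r)
    (h : ∀ ξ ∈ Metric.closedBall 0 r, x + lineMap w ξ ∈ D) :
    0 ≤ ∫ ξ in Metric.closedBall 0 r, (U (x + lineMap w ξ) - U x) := by
  have hfin : volume (Metric.closedBall (0 : Quaternion ℝ) r) ≠ ⊤ :=
    (isCompact_closedBall _ _).measure_ne_top
  have h1 := hU.submean x w r hr h
  have hi := hU.integrableOn_line x w r
  have hic (c : ℝ) : IntegrableOn (fun _ => c) (Metric.closedBall (0 : Quaternion ℝ) r) :=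
    integrableOn_const hfin
  have hMi : IntegrableOn (fun ξ => M - U (x + lineMap w ξ)) (Metric.closedBall 0 r) :=
    (hic M).sub hi
  rw [← ofReal_integral_eq_lintegral_ofReal hMi
    (.of_forall fun ξ => sub_nonneg.2 (abs_le.1 (hU.abs_le_bound _)).2),
    ← ENNReal.ofReal_toReal hfin, ← ENNReal.ofReal_mul ENNReal.toReal_nonneg,
    ENNReal.ofReal_le_ofReal_iff (mul_nonneg ENNReal.toReal_nonneg
      (sub_nonneg.2 (abs_le.1 (hU.abs_le_bound _)).2)), integral_sub (hic M) hi] at h1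
  rw [integral_sub hi (hic _)]
  simp only [setIntegral_const, smul_eq_mul, Measure.real] at h1 ⊢
  linarith

lemma integrable_mollify_integrand (hU : IsSubmean U D M) {ε : ℝ} (hε : 0 < ε) (x : Hn n) :
    Integrable fun y => mollifier n ε y * U (x - y) :=
  (integrable_mollifier hε).mul_bdd (c := M)
    (hU.measurable.comp (by fun_prop)).aestronglyMeasurable (.of_forall fun y => hU.abs_le_bound _)

lemma contDiff_mollify (hU : IsSubmean U D M) {ε : ℝ} (hε : 0 < ε) : ContDiff ℝ ∞ (mollify U ε) :=
  (hasCompactSupport_mollifier hε).contDiff_convolution_left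
    (ContinuousLinearMap.lsmul ℝ ℝ) (contDiff_mollifier ε) hU.integrable.locallyIntegrable

lemma mollify_le (hU : IsSubmean U D M) {ε c : ℝ} (hε : 0 < ε) {x : Hn n} (h : ∀ y ∈ Metric.closedBall x ε, U y ≤ c) :
    mollify U ε x ≤ c := by
  have : ∫ y, mollifier n ε y * c = c := by
    rw [integral_mul_const, integral_mollifier hε, one_mul]
  rw [← this]
  refine integral_mono (hU.integrable_mollify_integrand hε x)
    ((integrable_mollifier hε).mul_const c) fun y => ?_
  by_cases hy : ε < ‖y‖
  · simp [mollifier_eq_zero hε hy]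
  · exact mul_le_mul_of_nonneg_left (h _ (by simpa [dist_eq_norm] using hy)) (mollifier_nonneg ε y)

lemma abs_mollify_le (hU : IsSubmean U D M) {ε : ℝ} (hε : 0 < ε) (x : Hn n) : |mollify U ε x| ≤ M := by
  have h1 : |mollify U ε x| ≤ ∫ y, mollifier n ε y * M := by
    refine norm_integral_le_of_norm_le (f := fun y => mollifier n ε y * U (x - y))
      ((integrable_mollifier hε).mul_const M) (.of_forall fun y => ?_)
    rw [norm_mul, Real.norm_of_nonneg (mollifier_nonneg ε y)]
    exact mul_le_mul_of_nonneg_left (hU.abs_le_bound _) (mollifier_nonneg ε y)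
  rwa [integral_mul_const, integral_mollifier hε, one_mul] at h1

/-- Coordinate lines are right quaternionic lines and the mollifier is a product of radial weights,
so the mean value inequality can be applied one coordinate at a time to `y ↦ M - U (x - y)`. -/
lemma le_mollify (hU : IsSubmean U D M) {ε : ℝ} (hε : 0 < ε) {x : Hn n} (hx : Metric.closedBall x ε ⊆ D) :
    U x ≤ mollify U ε x := by
  classical
  set w : Quaternion ℝ → ℝ≥0∞ := fun ξ => ENNReal.ofReal (mollifierQ ε ξ)
  have hwm : Measurable w := (contDiff_mollifierQ ε).continuous.measurable.ennreal_ofReal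
  set F : Hn n → ℝ≥0∞ := fun y => ENNReal.ofReal (M - U (x - y)) with hF
  have hFm : Measurable F :=
    (measurable_const.sub (hU.measurable.comp (measurable_const.sub measurable_id))).ennreal_ofReal
  -- The value `⊤` off the ball makes the one-variable inequality trivial at base points outside and
  -- is invisible to the weights, which vanish there. In the sup norm the ball is a product of
  -- balls, so changing one coordinate within radius `ε` stays inside.
  set f : Hn n → ℝ≥0∞ := fun y => if y ∈ Metric.closedBall 0 ε then F y else ⊤ with hf
  have hfm : Measurable f := Measurable.ite measurableSet_closedBall hFm measurable_const
  have key (y : Hn n) (i : Fin n) :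
      ∫⁻ ξ, w ξ * f (Function.update y i ξ) ≤ f (Function.update y i 0) := by
    by_cases hy : Function.update y i 0 ∈ Metric.closedBall (0 : Hn n) ε
    · have hmem (ξ : Quaternion ℝ) (hξ : ‖ξ‖ ≤ ε) :
          Function.update y i ξ ∈ Metric.closedBall (0 : Hn n) ε := by
        rw [mem_closedBall_zero_iff, pi_norm_le_iff_of_nonneg hε.le] at hy ⊢
        intro l
        by_cases hl : l = i
        · subst hl; simpa using hξ
        · simpa [hl] using hy l
      have hline (ξ : Quaternion ℝ) : x - Function.update y i ξ =
          (x - Function.update y i 0) + lineMap (Pi.single i (-1)) ξ := by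
        ext1 l
        by_cases hl : l = i
        · subst hl; simp [lineMap_apply, sub_eq_add_neg]
        · simp [lineMap_apply, hl]
      have heq (ξ : Quaternion ℝ) : w ξ * f (Function.update y i ξ)
          = w ξ * F (Function.update y i ξ) := by
        by_cases hξ : ε < ‖ξ‖
        · simp [w, mollifierQ_eq_zero hε hξ]
        · rw [hf]; simp only [hmem ξ (not_lt.1 hξ), if_true]
      have hlc := lintegral_radial_mul_le (f := fun ξ => F (Function.update y i ξ))
        (C := F (Function.update y i 0)) (ε := ε) (ρ := mollifierQ ε)
        (hFm.comp (measurable_update y)) (contDiff_mollifierQ ε).continuous (mollifierQ_nonneg ε)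
        (fun ξ ζ h => mul_le_mul_of_nonneg_left (bump_anti ε h)
          (inv_nonneg.2 (integral_nonneg (bump_nonneg ε))))
        (fun ξ h => mollifierQ_eq_zero hε h) (fun r hr hrε => by
          simp only [hF]
          have := hU.submean (x - Function.update y i 0) (Pi.single i (-1)) r hr (fun ξ hξ => by
            rw [← hline]
            refine hx ?_
            have := hmem ξ ((mem_closedBall_zero_iff.1 hξ).trans hrε)
            simpa [dist_eq_norm] using this)
          simpa only [← hline] using this)
      rw [lintegral_mollifierQ hε, one_mul] at hlc
      simp only [heq]
      refine hlc.trans_eq ?_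
      rw [hf]
      simp only [hy, if_true]
    · have : f (Function.update y i 0) = ⊤ := by rw [hf]; simp only [hy, if_false]
      rw [this]
      exact le_top
  have hmain := lmarginal_prod_mul_le hwm (lintegral_mollifierQ hε).le Finset.univ hfm key 0
  rw [← lintegral_eq_lmarginal_univ, ← volume_pi] at hmain
  have hprod (y : Hn n) : (∏ l, w (y l)) * f y
      = ENNReal.ofReal (mollifier n ε y * (M - U (x - y))) := by
    rw [ENNReal.ofReal_mul (mollifier_nonneg ε y)]
    have : ENNReal.ofReal (mollifier n ε y) = ∏ l, w (y l) :=
      ENNReal.ofReal_prod_of_nonneg fun l _ => mollifierQ_nonneg ε (y l)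
    by_cases hy : ε < ‖y‖
    · rw [← this, mollifier_eq_zero hε hy]; simp
    · have hmem : y ∈ Metric.closedBall (0 : Hn n) ε := by simpa using hy
      rw [this, hf]
      simp only [hmem, if_true, hF]
  have hi : Integrable fun y => mollifier n ε y * (M - U (x - y)) := by
    simp only [mul_sub]
    exact ((integrable_mollifier hε).mul_const M).sub (hU.integrable_mollify_integrand hε x)
  have hval : ∫ y, mollifier n ε y * (M - U (x - y)) = M - mollify U ε x := by
    simp only [mul_sub]
    rw [integral_sub ((integrable_mollifier hε).mul_const M)
      (hU.integrable_mollify_integrand hε x), integral_mul_const, integral_mollifier hε, one_mul]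
    rfl
  simp only [hprod] at hmain
  rw [← ofReal_integral_eq_lintegral_ofReal hi (.of_forall fun y => mul_nonneg
    (mollifier_nonneg ε y) (sub_nonneg.2 (abs_le.1 (hU.abs_le_bound _)).2)), hval] at hmain
  have h0 : f (fun l => if l ∈ Finset.univ then 0 else (0 : Hn n) l)
      = ENNReal.ofReal (M - U x) := by
    have : (fun l => if l ∈ Finset.univ then 0 else (0 : Hn n) l) = (0 : Hn n) := by
      ext1 l; simp
    rw [this, hf]
    simp [hF, hε.le]
  rw [h0, ENNReal.ofReal_le_ofReal_iff (sub_nonneg.2 (abs_le.1 (hU.abs_le_bound _)).2)] at hmain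
  linarith

/-- By Fubini the integral is a weighted average over `y` of the same integrals for `U` centred at
`x - y`. Only `‖y‖ ≤ ε` matters, and those discs stay within `ε + δ` of `x`. -/
lemma setIntegral_mollify_nonneg (hU : IsSubmean U D M) {ε δ : ℝ} (hε : 0 < ε) {x w : Hn n} {r : ℝ} (hr : 0 < r)
    (hx : Metric.closedBall x (ε + δ) ⊆ D) (hw : ‖w‖ * r ≤ δ) :
    0 ≤ ∫ ξ in Metric.closedBall 0 r, (mollify U ε (x + lineMap w ξ) - mollify U ε x) := by
  have hfin : volume (Metric.closedBall (0 : Quaternion ℝ) r) ≠ ⊤ :=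
    (isCompact_closedBall _ _).measure_ne_top
  have : IsFiniteMeasure (volume.restrict (Metric.closedBall (0 : Quaternion ℝ) r)) :=
    ⟨by simpa using hfin.lt_top⟩
  have h1 (ξ : Quaternion ℝ) : mollify U ε (x + lineMap w ξ) - mollify U ε x
      = ∫ y, mollifier n ε y * (U (x - y + lineMap w ξ) - U (x - y)) := by
    rw [mollify, mollify, ← integral_sub (hU.integrable_mollify_integrand hε _)
      (hU.integrable_mollify_integrand hε _)]
    refine integral_congr_ae (.of_forall fun y => ?_)
    simp only [mul_sub, sub_add_eq_add_sub]
  simp only [h1]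
  rw [integral_integral_swap]
  · refine integral_nonneg fun y => ?_
    by_cases hy : ε < ‖y‖
    · simp [mollifier_eq_zero hε hy]
    · simp only [integral_const_mul]
      refine mul_nonneg (mollifier_nonneg ε y) (hU.setIntegral_nonneg hr fun ξ hξ => hx ?_)
      rw [mem_closedBall_iff_norm]
      have h2 : ‖lineMap w ξ‖ ≤ δ := (norm_lineMap_le w ξ).trans
        ((mul_le_mul_of_nonneg_left (mem_closedBall_zero_iff.1 hξ) (norm_nonneg w)).trans hw)
      have h3 : x - y + lineMap w ξ - x = -y + lineMap w ξ := by abel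
      rw [h3]
      refine (norm_add_le _ _).trans ?_
      rw [norm_neg]
      exact add_le_add (not_lt.1 hy) h2
  · have hp : Integrable (fun z : Quaternion ℝ × Hn n => (1 : ℝ) * mollifier n ε z.2)
        ((volume.restrict (Metric.closedBall (0 : Quaternion ℝ) r)).prod volume) :=
      (integrable_const (1 : ℝ)).mul_prod (integrable_mollifier hε)
    simp only [one_mul] at hp
    refine hp.mul_bdd (c := 2 * M) ?_ (.of_forall fun z => ?_)
    · refine Measurable.aestronglyMeasurable ?_
      exact (hU.measurable.comp (by fun_prop)).sub (hU.measurable.comp (by fun_prop))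
    · have h4 := abs_le.1 (hU.abs_le_bound (x - z.2 + lineMap w z.1))
      have h5 := abs_le.1 (hU.abs_le_bound (x - z.2))
      rw [Real.norm_eq_abs, abs_le]
      constructor <;> linarith

end IsSubmean

/-! ### The mean value inequality and the Hessian -/

lemma norm_quatBasis (e : Fin 4) : ‖quatBasis e‖ = 1 := by
  have : ‖quatBasis e‖ * ‖quatBasis e‖ = 1 := by
    rw [← Quaternion.normSq_eq_norm_mul_self, Quaternion.normSq_def']
    fin_cases e <;> simp [quatBasis]
  nlinarith [norm_nonneg (quatBasis e)]

lemma norm_sq_quat (ξ : Quaternion ℝ) :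
    ‖ξ‖ ^ 2 = ξ.re ^ 2 + ξ.imI ^ 2 + ξ.imJ ^ 2 + ξ.imK ^ 2 := by
  rw [sq, ← Quaternion.normSq_eq_norm_mul_self, Quaternion.normSq_def']

/-- The trace of a symmetric form on `ℍ` does not depend on the orthogonal basis. -/
lemma sum_bilin_mul_quatBasis (b : Quaternion ℝ →L[ℝ] Quaternion ℝ →L[ℝ] ℝ)
    (hb : ∀ p q, b p q = b q p) (ξ : Quaternion ℝ) :
    ∑ e, b (ξ * quatBasis e) (ξ * quatBasis e) = ‖ξ‖ ^ 2 * ∑ e, b (quatBasis e) (quatBasis e) := by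
  obtain ⟨β, hβs, hβ⟩ : ∃ β : Fin 4 → Fin 4 → ℝ, (∀ a c, β a c = β c a) ∧
      ∀ p q, b p q = ∑ a, ∑ c, quatCoord p a * quatCoord q c * β a c := by
    refine ⟨fun a c => b (quatBasis a) (quatBasis c), fun a c => hb _ _, fun p q => ?_⟩
    conv_lhs => rw [sum_quatCoord p, sum_quatCoord q]
    simp only [map_sum, map_smul, sum_apply, smul_apply, smul_eq_mul, Finset.mul_sum]
    rw [Finset.sum_comm]
    exact Finset.sum_congr rfl fun _ _ => Finset.sum_congr rfl fun _ _ => by ring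
  rw [norm_sq_quat]
  simp only [hβ]
  simp [Fin.sum_univ_four, quatCoord, quatBasis]
  rw [hβs 1 0, hβs 2 0, hβs 3 0, hβs 2 1, hβs 3 1, hβs 3 2]
  ring

/-- Right multiplication by a quaternion of norm one, as an isometry. -/
def rightMulIsometry (e : Quaternion ℝ) (he : ‖e‖ = 1) : Quaternion ℝ ≃ₗᵢ[ℝ] Quaternion ℝ where
  toFun ξ := ξ * e
  invFun ξ := ξ * star e
  map_add' ξ ζ := add_mul ξ ζ e
  map_smul' c ξ := smul_mul_assoc c ξ e
  left_inv ξ := by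
    change ξ * e * star e = ξ
    rw [mul_assoc, Quaternion.self_mul_star, Quaternion.normSq_eq_norm_mul_self, he]; simp
  right_inv ξ := by
    change ξ * star e * e = ξ
    rw [mul_assoc, Quaternion.star_mul_self, Quaternion.normSq_eq_norm_mul_self, he]; simp
  norm_map' ξ := by simp [he]

lemma setIntegral_closedBall_mul_right (f : Quaternion ℝ → ℝ) (r : ℝ) {e : Quaternion ℝ}
    (he : ‖e‖ = 1) :
    ∫ ξ in Metric.closedBall 0 r, f (ξ * e) = ∫ ξ in Metric.closedBall 0 r, f ξ := by
  have h := (rightMulIsometry e he).measurePreserving.setIntegral_preimage_emb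
    (rightMulIsometry e he).toMeasurableEquiv.measurableEmbedding f (Metric.closedBall 0 r)
  have hp : (rightMulIsometry e he) ⁻¹' (Metric.closedBall 0 r) = Metric.closedBall 0 r := by
    ext ξ
    simp
  rw [hp] at h
  exact h

lemma lt_of_second_deriv_neg {g g' g'' : ℝ → ℝ} (h1 : ∀ t, HasDerivAt g (g' t) t)
    (h2 : ∀ t, HasDerivAt g' (g'' t) t) (h0 : g' 0 = 0) (hneg : ∀ t ∈ Set.Ioo (0 : ℝ) 1, g'' t < 0) :
    g 1 < g 0 := by
  have ha : StrictAntiOn g' (Set.Icc 0 1) := by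
    refine strictAntiOn_of_deriv_neg (convex_Icc 0 1)
      (fun t _ => (h2 t).continuousAt.continuousWithinAt) fun t ht => ?_
    rw [interior_Icc] at ht
    rw [(h2 t).deriv]
    exact hneg t ht
  have hb : StrictAntiOn g (Set.Icc 0 1) := by
    refine strictAntiOn_of_deriv_neg (convex_Icc 0 1)
      (fun t _ => (h1 t).continuousAt.continuousWithinAt) fun t ht => ?_
    rw [interior_Icc] at ht
    rw [(h1 t).deriv, ← h0]
    exact ha (by simp) (Set.Ioo_subset_Icc_self ht) ht.1
  exact hb (by simp) (by simp) zero_lt_one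

lemma hasDerivAt_line {E F : Type*} [NormedAddCommGroup E] [NormedSpace ℝ E]
    [NormedAddCommGroup F] [NormedSpace ℝ F] {f : E → F} (hf : Differentiable ℝ f) (x h : E) (t : ℝ) :
    HasDerivAt (fun s : ℝ => f (x + s • h)) (fderiv ℝ f (x + t • h) h) t := by
  have h1 : HasDerivAt (fun s : ℝ => x + s • h) h t := by
    simpa using ((hasDerivAt_id t).smul_const h).const_add x
  exact (hf (x + t • h)).hasFDerivAt.comp_hasDerivAt t h1

/-- A strict form of the second order Taylor expansion along several pairs of opposite rays. -/
lemma sum_symm_lt_of_hess_neg {E ι : Type*} [Fintype ι] [NormedAddCommGroup E] [NormedSpace ℝ E]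
    {v : E → ℝ} (hv : ContDiff ℝ ∞ v) (x : E) (h : ι → E)
    (hneg : ∀ t ∈ Set.Ioo (0 : ℝ) 1, ∑ e, (fderiv ℝ (fderiv ℝ v) (x + t • h e) (h e) (h e)
      + fderiv ℝ (fderiv ℝ v) (x + t • -h e) (h e) (h e)) < 0) :
    ∑ e, ((v (x + h e) - v x) + (v (x + -h e) - v x)) < 0 := by
  have hd : Differentiable ℝ v := hv.differentiable (by simp)
  have hd2 : Differentiable ℝ (fderiv ℝ v) :=
    (hv.fderiv_right (m := ∞) (by simp)).differentiable (by simp)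
  have hfd (y k : E) (t : ℝ) : HasDerivAt (fun s : ℝ => fderiv ℝ v (x + s • y) k)
      (fderiv ℝ (fderiv ℝ v) (x + t • y) y k) t := by
    simpa using (hasDerivAt_line hd2 x y t).clm_apply (hasDerivAt_const t k)
  -- The two opposite rays make the first derivative of the sum vanish at `t = 0`; a negative second
  -- derivative on `(0, 1)` then forces a strict decrease.
  have := lt_of_second_deriv_neg
    (g := fun t => ∑ e, (v (x + t • h e) + v (x + t • -h e)))
    (g' := fun t => ∑ e, (fderiv ℝ v (x + t • h e) (h e) + fderiv ℝ v (x + t • -h e) (-h e)))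
    (g'' := fun t => ∑ e, (fderiv ℝ (fderiv ℝ v) (x + t • h e) (h e) (h e)
      + fderiv ℝ (fderiv ℝ v) (x + t • -h e) (-h e) (-h e)))
    (fun t => HasDerivAt.fun_sum fun e _ =>
      (hasDerivAt_line hd x (h e) t).add (hasDerivAt_line hd x (-h e) t))
    (fun t => HasDerivAt.fun_sum fun e _ => (hfd (h e) (h e) t).add (hfd (-h e) (-h e) t))
    (by simp) (fun t ht => by simpa using hneg t ht)
  simp only [one_smul, zero_smul, add_zero] at this
  have h3 : ∑ e, ((v (x + h e) - v x) + (v (x + -h e) - v x))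
      = ∑ e, (v (x + h e) + v (x + -h e)) - ∑ _e : ι, (v x + v x) := by
    rw [← Finset.sum_sub_distrib]
    exact Finset.sum_congr rfl fun e _ => by ring
  rw [h3]
  linarith

lemma exists_norm_sub_lt {E F : Type*} [NormedAddCommGroup E] [NormedAddCommGroup F] {f : E → F}
    (hf : Continuous f) (x : E) {κ : ℝ} (hκ : 0 < κ) :
    ∃ δ > 0, ∀ y, dist y x < δ → ‖f y - f x‖ < κ := by
  simpa only [dist_eq_norm] using Metric.continuous_iff.1 hf x κ hκ

/-- Continuity of the second derivative in operator norm makes `δ` uniform in the direction `k`. -/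
lemma exists_hess_le_add {E : Type*} [NormedAddCommGroup E] [NormedSpace ℝ E] {v : E → ℝ}
    (hv : ContDiff ℝ ∞ v) (x : E) {κ : ℝ} (hκ : 0 < κ) :
    ∃ δ > 0, ∀ y, dist y x < δ → ∀ k, fderiv ℝ (fderiv ℝ v) y k k ≤
      fderiv ℝ (fderiv ℝ v) x k k + κ * (‖k‖ * ‖k‖) := by
  have hcont : Continuous (fderiv ℝ (fderiv ℝ v)) :=
    ((hv.fderiv_right (m := ∞) (by simp)).fderiv_right (m := ∞) (by simp)).continuous
  obtain ⟨δ, hδ, hδq⟩ :=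
    exists_norm_sub_lt (F := E →L[ℝ] E →L[ℝ] ℝ) hcont x hκ
  refine ⟨δ, hδ, fun y hy k => ?_⟩
  have h1 := (hδq y hy).le
  have h2 := ContinuousLinearMap.le_opNorm₂
    (fderiv ℝ (fderiv ℝ v) y - fderiv ℝ (fderiv ℝ v) x) k k
  rw [mul_assoc] at h2
  have h3 := (le_abs_self _).trans (h2.trans (mul_le_mul_of_nonneg_right h1 (by positivity)))
  simp only [sub_apply] at h3
  linarith

/-- The mean value inequality on small balls of a right quaternionic line makes the trace of the
Hessian along that line nonnegative. -/
theorem hess_trace_nonneg {v : Hn n → ℝ} (hv : ContDiff ℝ ∞ v) (x w : Hn n) {r₀ : ℝ} (hr₀ : 0 < r₀)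
    (h : ∀ r, 0 < r → r ≤ r₀ →
      0 ≤ ∫ ξ in Metric.closedBall 0 r, (v (x + lineMap w ξ) - v x)) :
    0 ≤ ∑ e, fderiv ℝ (fderiv ℝ v) x (rightMul (quatBasis e) w) (rightMul (quatBasis e) w) := by
  set q := fderiv ℝ (fderiv ℝ v) x with hq
  have hsymm (y z : Hn n) : q y z = q z y :=
    (hv.contDiffAt.isSymmSndFDerivAt
      (by simpa using WithTop.coe_le_coe.2 (le_top (a := (2 : ℕ∞))))).eq y z
  have hrl (e : Quaternion ℝ) : rightMul e w = lineMap w e := rfl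
  simp only [hrl]
  by_contra! hc
  set c := ∑ e, q (lineMap w (quatBasis e)) (lineMap w (quatBasis e)) with hcdef
  have htr (ξ : Quaternion ℝ) : ∑ e, q (lineMap w (ξ * quatBasis e)) (lineMap w (ξ * quatBasis e))
      = ‖ξ‖ ^ 2 * c :=
    sum_bilin_mul_quatBasis (q.bilinearComp (lineMap w) (lineMap w)) (fun p q => hsymm _ _) ξ
  -- Chosen so that the errors of the four directions together use up at most half of `-c`.
  set κ : ℝ := -c / (8 * (‖w‖ ^ 2 + 1)) with hκ
  have hκpos : 0 < κ := div_pos (neg_pos.2 hc) (by positivity)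
  have hκw : 4 * κ * ‖w‖ ^ 2 ≤ -c / 2 := by
    have h1 : κ * (8 * (‖w‖ ^ 2 + 1)) = -c := div_mul_cancel₀ _ (by positivity)
    linarith
  obtain ⟨δ, hδ, hδq⟩ := exists_hess_le_add hv x hκpos
  set r := min r₀ (δ / (‖w‖ + 1) / 2) with hr
  have hrpos : 0 < r := lt_min hr₀ (by positivity)
  have hrδ : ‖w‖ * r < δ := by
    have h1 : r < δ / (‖w‖ + 1) := (min_le_right _ _).trans_lt (half_lt_self (by positivity))
    rw [lt_div_iff₀ (by positivity)] at h1
    nlinarith [norm_nonneg w]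
  -- Symmetric second differences along the directions `w ξ e`. Their Hessian terms at `x` add up to
  -- `‖ξ‖² c` for every `ξ`, so `G` is negative at each nonzero `ξ` of the ball, not just on
  -- average.
  set G : Quaternion ℝ → ℝ := fun ξ => ∑ e, ((v (x + lineMap w (ξ * quatBasis e)) - v x)
    + (v (x + -lineMap w (ξ * quatBasis e)) - v x)) with hG
  have hGneg (ξ : Quaternion ℝ) (hξ : ‖ξ‖ ≤ r) (hξ0 : ξ ≠ 0) : G ξ < 0 := by
    refine sum_symm_lt_of_hess_neg hv x (fun e => lineMap w (ξ * quatBasis e)) fun t ht => ?_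
    have hn (e : Fin 4) : ‖lineMap w (ξ * quatBasis e)‖ ≤ ‖w‖ * ‖ξ‖ := by
      refine (norm_lineMap_le w _).trans_eq ?_
      rw [norm_mul, norm_quatBasis, mul_one]
    have hest (s : ℝ) (hs : |s| < 1) (e : Fin 4) :
        fderiv ℝ (fderiv ℝ v) (x + s • lineMap w (ξ * quatBasis e))
          (lineMap w (ξ * quatBasis e)) (lineMap w (ξ * quatBasis e)) ≤
        q (lineMap w (ξ * quatBasis e)) (lineMap w (ξ * quatBasis e))
          + κ * (‖w‖ ^ 2 * ‖ξ‖ ^ 2) := by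
      set k := lineMap w (ξ * quatBasis e)
      have hd : dist (x + s • k) x < δ := by
        rw [dist_eq_norm, add_sub_cancel_left, norm_smul, Real.norm_eq_abs]
        have h1 : ‖w‖ * ‖ξ‖ ≤ ‖w‖ * r := mul_le_mul_of_nonneg_left hξ (norm_nonneg w)
        have h2 : |s| * ‖k‖ ≤ 1 * ‖k‖ := mul_le_mul_of_nonneg_right hs.le (norm_nonneg k)
        linarith [hn e]
      have h1 := hδq _ hd k
      have h3 : ‖k‖ * ‖k‖ ≤ ‖w‖ ^ 2 * ‖ξ‖ ^ 2 := by
        have := mul_le_mul (hn e) (hn e) (norm_nonneg k) (by positivity)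
        nlinarith
      exact h1.trans (by gcongr)
    have ht1 : |t| < 1 := abs_lt.2 ⟨by linarith [ht.1], ht.2⟩
    have hsum : ∑ e, (fderiv ℝ (fderiv ℝ v) (x + t • lineMap w (ξ * quatBasis e))
          (lineMap w (ξ * quatBasis e)) (lineMap w (ξ * quatBasis e))
        + fderiv ℝ (fderiv ℝ v) (x + t • -lineMap w (ξ * quatBasis e))
          (lineMap w (ξ * quatBasis e)) (lineMap w (ξ * quatBasis e))) ≤
        ∑ e, 2 * (q (lineMap w (ξ * quatBasis e)) (lineMap w (ξ * quatBasis e))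
          + κ * (‖w‖ ^ 2 * ‖ξ‖ ^ 2)) := by
      refine Finset.sum_le_sum fun e _ => ?_
      have h1 := hest t ht1 e
      have h2 := hest (-t) (by rwa [abs_neg]) e
      rw [neg_smul, ← smul_neg] at h2
      linarith
    refine hsum.trans_lt ?_
    rw [← Finset.mul_sum, Finset.sum_add_distrib, htr]
    simp only [Finset.sum_const, Finset.card_univ, Fintype.card_fin, nsmul_eq_mul]
    have hξpos : 0 < ‖ξ‖ ^ 2 := by positivity
    have : ‖ξ‖ ^ 2 * (c + 4 * κ * ‖w‖ ^ 2) < 0 := mul_neg_of_pos_of_neg hξpos (by linarith)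
    push_cast
    nlinarith
  have hfi (f : Quaternion ℝ → ℝ) (hf : Continuous f) : IntegrableOn f (Metric.closedBall 0 r) :=
    hf.continuousOn.integrableOn_compact (isCompact_closedBall _ _)
  have hvc : Continuous v := hv.continuous
  -- Right multiplication by `e` or `-e` preserves the ball and its measure, so the eight
  -- differences have equal integrals. The sign of `∫ G` then contradicts `h`.
  have hGint : ∫ ξ in Metric.closedBall 0 r, G ξ =
      8 * ∫ ξ in Metric.closedBall 0 r, (v (x + lineMap w ξ) - v x) := by
    rw [hG, integral_finsetSum]
    · have h1 (e : Fin 4) : ∫ ξ in Metric.closedBall 0 r, ((v (x + lineMap w (ξ * quatBasis e)) - v x)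
          + (v (x + -lineMap w (ξ * quatBasis e)) - v x)) =
          2 * ∫ ξ in Metric.closedBall 0 r, (v (x + lineMap w ξ) - v x) := by
        rw [integral_add (hfi _ (by fun_prop)) (hfi _ (by fun_prop)), two_mul]
        congr 1
        · exact setIntegral_closedBall_mul_right (fun ξ => v (x + lineMap w ξ) - v x) r
            (norm_quatBasis e)
        · have := setIntegral_closedBall_mul_right (fun ξ => v (x + lineMap w ξ) - v x) r
            (e := -quatBasis e) (by rw [norm_neg, norm_quatBasis])
          simpa only [mul_neg, map_neg] using this
      simp only [h1]
      simp
      ring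
    · exact fun e _ => hfi _ (by fun_prop)
  have hGc : Continuous G := by fun_prop
  have hpos : 0 < ∫ ξ in Metric.closedBall 0 r, -G ξ := by
    rw [setIntegral_pos_iff_support_of_nonneg_ae]
    · have hsub : Metric.closedBall (0 : Quaternion ℝ) r \ {0} ⊆
          Function.support (fun ξ => -G ξ) ∩ Metric.closedBall 0 r := by
        rintro ξ ⟨h1, h2⟩
        exact ⟨(neg_pos.2 (hGneg ξ (mem_closedBall_zero_iff.1 h1) h2)).ne', h1⟩
      refine lt_of_lt_of_le ?_ (measure_mono hsub)
      rw [measure_sdiff_null (measure_singleton _)]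
      exact Metric.measure_closedBall_pos _ _ hrpos
    · rw [Filter.EventuallyLE, ae_restrict_iff' measurableSet_closedBall]
      refine .of_forall fun ξ hξ => ?_
      by_cases h0 : ξ = 0
      · subst h0; simp [hG]
      · exact (neg_pos.2 (hGneg ξ (mem_closedBall_zero_iff.1 hξ) h0)).le
    · exact hfi _ hGc.neg
  rw [integral_neg, hGint] at hpos
  have := h r hrpos (min_le_left _ _)
  linarith

end QuatPluripotential

end

noncomputable section

namespace QuatPluripotential

open scoped ContDiff ENNReal
open MeasureTheory Filter

variable {n : ℕ} {Ω : TopologicalSpace.Opens (Hn n)}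

/-! ### Regularization of plurisubharmonic functions -/

lemma IsLocallyBounded.exists_bound {u : Hn n → EReal} (hu : IsLocallyBounded Ω u) {D : Set (Hn n)}
    (hD : IsCompact D) (hDΩ : D ⊆ Ω) :
    ∃ M : ℝ, ∀ x ∈ D, ((-M : ℝ) : EReal) ≤ u x ∧ u x ≤ (M : EReal) := by
  refine hD.induction_on (p := fun s => ∃ M : ℝ, ∀ x ∈ s, ((-M : ℝ) : EReal) ≤ u x ∧ u x ≤ (M : EReal))
    ⟨0, by simp⟩ (fun s t hst ⟨M, hM⟩ => ⟨M, fun x hx => hM x (hst hx)⟩) ?_ ?_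
  · rintro s t ⟨M, hM⟩ ⟨N, hN⟩
    refine ⟨max M N, fun x hx => ?_⟩
    rcases hx with hx | hx
    · refine ⟨le_trans ?_ (hM x hx).1, (hM x hx).2.trans ?_⟩
      · exact EReal.coe_le_coe_iff.2 (neg_le_neg (le_max_left _ _))
      · exact EReal.coe_le_coe_iff.2 (le_max_left _ _)
    · refine ⟨le_trans ?_ (hN x hx).1, (hN x hx).2.trans ?_⟩
      · exact EReal.coe_le_coe_iff.2 (neg_le_neg (le_max_right _ _))
      · exact EReal.coe_le_coe_iff.2 (le_max_right _ _)
  · intro x hx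
    obtain ⟨M, hM⟩ := hu x (hDΩ hx)
    exact ⟨_, mem_nhdsWithin_of_mem_nhds hM, M, fun y hy => hy⟩

lemma coe_toReal_of_mem_Icc {t : EReal} {M : ℝ} (h : ((-M : ℝ) : EReal) ≤ t ∧ t ≤ (M : EReal)) :
    ((t.toReal : ℝ) : EReal) = t ∧ |t.toReal| ≤ M := by
  have h1 : ((t.toReal : ℝ) : EReal) = t :=
    EReal.coe_toReal (ne_top_of_le_ne_top (EReal.coe_ne_top _) h.2)
      (ne_bot_of_le_ne_bot (EReal.coe_ne_bot _) h.1)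
  refine ⟨h1, abs_le.2 ⟨?_, ?_⟩⟩
  · exact EReal.coe_le_coe_iff.1 (h1 ▸ h.1)
  · exact EReal.coe_le_coe_iff.1 (h1 ▸ h.2)

/-- The restriction of an upper semicontinuous function to a closed set is Borel measurable. -/
lemma measurable_indicator_toReal {u : Hn n → EReal} (hu : UpperSemicontinuousOn u (Ω : Set (Hn n)))
    {D : Set (Hn n)} (hD : IsClosed D) (hDΩ : D ⊆ Ω) :
    Measurable (D.indicator fun x => (u x).toReal) := by
  classical
  have husc : UpperSemicontinuous fun x => if x ∈ D then u x else ⊥ := by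
    intro x c hc
    by_cases hx : x ∈ D
    · simp only [hx, if_true] at hc
      have h1 := hu x (hDΩ hx) c hc
      rw [IsOpen.nhdsWithin_eq Ω.isOpen (hDΩ hx)] at h1
      filter_upwards [h1] with y hy
      split_ifs
      · exact hy
      · exact bot_le.trans_lt hc
    · filter_upwards [hD.isOpen_compl.mem_nhds hx] with y hy
      simp only [hx, if_false] at hc
      have : y ∉ D := hy
      simpa only [this, if_false] using hc
  have h2 := husc.measurable.ereal_toReal
  convert h2 using 1
  ext x
  by_cases hx : x ∈ D <;> simp [hx]

/-- Setting `u` to 0 outside `D` gives a bounded integrable function on all of `ℍⁿ`, and the mean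
value inequality is only asked for discs in `D`, where nothing has changed. -/
lemma IsPSH.isSubmean {u : Hn n → EReal} (hu : IsPSH Ω u) {D : Set (Hn n)} (hD : IsCompact D)
    (hDΩ : D ⊆ Ω) {M : ℝ} (hM0 : 0 ≤ M)
    (hM : ∀ x ∈ D, ((-M : ℝ) : EReal) ≤ u x ∧ u x ≤ (M : EReal)) :
    IsSubmean (D.indicator fun x => (u x).toReal) D M := by
  have hmeas := measurable_indicator_toReal hu.1 hD.isClosed hDΩ
  have hb (x : Hn n) : |D.indicator (fun x => (u x).toReal) x| ≤ M := by
    by_cases hx : x ∈ D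
    · rw [Set.indicator_of_mem hx]; exact (coe_toReal_of_mem_Icc (hM x hx)).2
    · rw [Set.indicator_of_notMem hx]; simpa using hM0
  refine ⟨hmeas, hb, ?_, fun x w r hr hxw => ?_⟩
  · have h1 : IntegrableOn (D.indicator fun x => (u x).toReal) D :=
      Measure.integrableOn_of_bounded (M := M) hD.measure_ne_top hmeas.aestronglyMeasurable
        (.of_forall hb)
    rw [integrableOn_iff_integrable_of_support_subset] at h1
    · exact h1
    · exact Set.support_indicator_subset
  -- Plurisubharmonicity concerns genuine lines only; for `w = 0` the function is constant and
  -- equality holds.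
  · by_cases hw : w = 0
    · have hl (ξ : Quaternion ℝ) : lineMap w ξ = 0 := by
        subst hw; ext1 l; simp [lineMap_apply]
      simp only [hl, add_zero, setLIntegral_const]
      rw [mul_comm]
    · have hval (y : Hn n) (hy : y ∈ D) : ((M : EReal) - u y).toENNReal
          = ENNReal.ofReal (M - D.indicator (fun x => (u x).toReal) y) := by
        rw [Set.indicator_of_mem hy]
        conv_lhs => rw [← (coe_toReal_of_mem_Icc (hM y hy)).1, ← EReal.coe_sub]
        exact EReal.toENNReal_of_ne_top (EReal.coe_ne_top _)
      have hx0 : x ∈ D := by simpa using hxw 0 (by simp [hr.le])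
      have h1 := (hu.2.2 x w hw).2.2 0 r hr (fun ξ hξ => hDΩ (hxw ξ hξ)) M
        (fun ξ hξ => (hM _ (hxw ξ hξ)).2)
      have h2 : ((M : EReal) - u (fun l => x l + w l * 0)).toENNReal
          = ENNReal.ofReal (M - D.indicator (fun x => (u x).toReal) x) := by
        rw [← hval x hx0]; simp
      rw [h2] at h1
      refine le_trans (le_of_eq ?_) h1
      exact setLIntegral_congr_fun measurableSet_closedBall fun ξ hξ => (hval _ (hxw ξ hξ)).symm

/-- Smooth approximation of a locally bounded plurisubharmonic function near a compact set. -/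
theorem IsPSH.exists_smooth_approx {u : Hn n → EReal} (hu : IsPSH Ω u) (hlb : IsLocallyBounded Ω u)
    {K : Set (Hn n)} (hK : IsCompact K) (hKΩ : K ⊆ Ω) :
    ∃ (v : ℕ → Hn n → ℝ) (M : ℝ), (∀ i, ContDiff ℝ ∞ (v i)) ∧ (∀ i x, |v i x| ≤ M) ∧
      (∀ x ∈ K, Tendsto (fun i => v i x) atTop (nhds (u x).toReal)) ∧
      ∀ i, ∀ x ∈ K, ∀ w, 0 ≤ ∑ e, fderiv ℝ (fderiv ℝ (v i)) x
        (rightMul (quatBasis e) w) (rightMul (quatBasis e) w) := by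
  -- The room `δ` around `K` is split: at most `δ / 2` for the radius of mollification and `δ / 2`
  -- for the discs on which the mean value inequality is tested.
  obtain ⟨δ, hδ, hδΩ⟩ := hK.exists_cthickening_subset_open Ω.isOpen hKΩ
  set D := Metric.cthickening δ K with hDdef
  have hD : IsCompact D := hK.cthickening
  obtain ⟨M', hM'⟩ := hlb.exists_bound hD hδΩ
  set M := max M' 0
  have hM (x) (hx : x ∈ D) : ((-M : ℝ) : EReal) ≤ u x ∧ u x ≤ (M : EReal) :=
    ⟨le_trans (EReal.coe_le_coe_iff.2 (neg_le_neg (le_max_left _ _))) (hM' x hx).1,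
      (hM' x hx).2.trans (EReal.coe_le_coe_iff.2 (le_max_left _ _))⟩
  set U := D.indicator fun x => (u x).toReal with hUdef
  have hU : IsSubmean U D M := hu.isSubmean hD hδΩ (le_max_right _ _) hM
  have hball (x) (hx : x ∈ K) : Metric.closedBall x δ ⊆ D := Metric.closedBall_subset_cthickening hx δ
  set ε : ℕ → ℝ := fun i => δ / 2 / (i + 1) with hε
  have hεpos (i : ℕ) : 0 < ε i := by positivity
  have hεle (i : ℕ) : ε i ≤ δ / 2 := div_le_self (by positivity) (by linarith [i.cast_nonneg (α := ℝ)])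
  have hεlim : Tendsto ε atTop (nhds 0) := by
    have := (tendsto_one_div_add_atTop_nhds_zero_nat (𝕜 := ℝ)).const_mul (δ / 2)
    simpa [hε, div_eq_mul_inv] using this
  refine ⟨fun i => mollify U (ε i), M, fun i => hU.contDiff_mollify (hεpos i),
    fun i x => hU.abs_mollify_le (hεpos i) x, fun x hx => ?_, fun i x hx w => ?_⟩
  · have hxD : x ∈ D := hball x hx (Metric.mem_closedBall_self hδ.le)
    have hUx : (u x).toReal = U x := by rw [hUdef, Set.indicator_of_mem hxD]
    rw [hUx]
    -- The mollifications lie above `U` by the mean value inequality; upper semicontinuity bounds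
    -- them from above in the limit.
    refine tendsto_order.2 ⟨fun c hc => .of_forall fun i => hc.trans_le (hU.le_mollify (hεpos i)
      ((Metric.closedBall_subset_closedBall ((hεle i).trans (by linarith))).trans (hball x hx))),
      fun c hc => ?_⟩
    obtain ⟨c', hc', hcc'⟩ := exists_between hc
    have h1 : ∀ᶠ y in nhds x, U y < c' := by
      have h2 : u x < (c' : EReal) := by
        rw [← (coe_toReal_of_mem_Icc (hM x hxD)).1, hUx]
        exact EReal.coe_lt_coe_iff.2 hc'
      have h3 := hu.1 x (hδΩ hxD) c' h2
      rw [IsOpen.nhdsWithin_eq Ω.isOpen (hδΩ hxD)] at h3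
      filter_upwards [h3, Metric.closedBall_mem_nhds x hδ] with y hy hyδ
      have hyD := hball x hx hyδ
      rw [hUdef, Set.indicator_of_mem hyD]
      rw [← (coe_toReal_of_mem_Icc (hM y hyD)).1] at hy
      exact EReal.coe_lt_coe_iff.1 hy
    obtain ⟨r, hr, hrU⟩ := Metric.eventually_nhds_iff_ball.1 h1
    filter_upwards [hεlim.eventually_lt_const hr] with i hi
    exact (hU.mollify_le (hεpos i) fun y hy =>
      (hrU y (lt_of_le_of_lt (Metric.mem_closedBall.1 hy) hi)).le).trans_lt hcc'
  · have hw : 0 < ‖w‖ + 1 := by positivity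
    refine hess_trace_nonneg (hU.contDiff_mollify (hεpos i)) x w (r₀ := δ / 2 / (‖w‖ + 1))
      (by positivity) fun r hr hr₀ => ?_
    refine hU.setIntegral_mollify_nonneg (δ := δ / 2) (hεpos i) hr ?_ ?_
    · exact (Metric.closedBall_subset_closedBall (by linarith [hεle i])).trans (hball x hx)
    · rw [le_div_iff₀ hw] at hr₀
      nlinarith [norm_nonneg w]

end QuatPluripotential

end

noncomputable section

namespace QuatPluripotential

open scoped ContDiff ENNReal CompactlySupported
open MeasureTheory Filter

variable {n : ℕ} {Ω : TopologicalSpace.Opens (Hn n)}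

/-! ### Positive functionals on test functions are measures -/

/-- A nonnegative test function that is at least `1` on a given compact set. -/
lemma exists_testFunction_ge_one {K : Set (Hn n)} (hK : IsCompact K) (hKΩ : K ⊆ Ω) :
    ∃ φ : 𝓓(Ω, ℝ), (∀ x, 0 ≤ φ x) ∧ ∀ x ∈ K, 1 ≤ φ x := by
  obtain ⟨L, hL, hKL, hLΩ⟩ := exists_compact_between hK Ω.isOpen hKΩ
  obtain ⟨f, hf, hfs, hf0⟩ := isOpen_interior.exists_contDiff_support_eq (n := ⊤) (s := interior L)
  have hfL : tsupport f ⊆ L := by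
    rw [tsupport, hf]
    exact closure_minimal interior_subset hL.isClosed
  have hpos (x) (hx : x ∈ K) : 0 < f x :=
    lt_of_le_of_ne (hf0 (Set.mem_range_self x)).1 (by
      have : x ∈ Function.support f := hf ▸ hKL hx
      exact (Function.mem_support.1 this).symm)
  obtain ⟨m, hm, hmK⟩ : ∃ m > 0, ∀ x ∈ K, m ≤ f x := by
    rcases K.eq_empty_or_nonempty with rfl | hne
    · exact ⟨1, one_pos, by simp⟩
    · obtain ⟨x₀, hx₀, hmin⟩ := hK.exists_isMinOn hne hfs.continuous.continuousOn
      exact ⟨f x₀, hpos x₀ hx₀, fun x hx => hmin hx⟩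
  let φ : 𝓓(Ω, ℝ) := ⟨f, hfs, hL.of_isClosed_subset (isClosed_tsupport f) hfL, hfL.trans hLΩ⟩
  refine ⟨m⁻¹ • φ, fun x => ?_, fun x hx => ?_⟩
  · exact mul_nonneg (inv_nonneg.2 hm.le) (hf0 (Set.mem_range_self x)).1
  · change 1 ≤ m⁻¹ * f x
    rw [inv_mul_eq_div, le_div_iff₀ hm, one_mul]
    exact hmK x hx

/-- The restriction of a test function to `Ω`. -/
def restrictTest : 𝓓(Ω, ℝ) →ₗ[ℝ] C_c(Ω, ℝ) where
  toFun φ :=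
    { toFun := fun x => φ x
      continuous_toFun := φ.continuous.comp continuous_subtype_val
      hasCompactSupport' := by
        have h : IsCompact ((Subtype.val : Ω → Hn n) ⁻¹' tsupport φ) :=
          Topology.IsEmbedding.subtypeVal.isInducing.isCompact_preimage' φ.hasCompactSupport
            (by simpa using φ.tsupport_subset)
        refine HasCompactSupport.of_support_subset_isCompact h fun x hx => subset_closure hx }
  map_add' _ _ := rfl
  map_smul' _ _ := rfl

lemma restrictTest_injective : Function.Injective (restrictTest (Ω := Ω)) := by
  intro φ ψ h
  ext x
  by_cases hx : x ∈ Ω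
  · exact DFunLike.congr_fun h (⟨x, hx⟩ : Ω)
  · rw [image_eq_zero_of_notMem_tsupport fun h => hx (φ.tsupport_subset h),
      image_eq_zero_of_notMem_tsupport fun h => hx (ψ.tsupport_subset h)]

/-- A positive functional on test functions extends to a positive functional on continuous functions
with compact support. -/
lemma exists_positive_extension (Λ : 𝓓(Ω, ℝ) →ₗ[ℝ] ℝ)
    (hΛ : ∀ φ : 𝓓(Ω, ℝ), (∀ x, 0 ≤ φ x) → 0 ≤ Λ φ) :
    ∃ g : C_c(Ω, ℝ) →ₚ[ℝ] ℝ, ∀ φ, g (restrictTest φ) = Λ φ := by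
  let e := LinearEquiv.ofInjective (restrictTest (Ω := Ω)) restrictTest_injective
  let s : PointedCone ℝ C_c(Ω, ℝ) :=
    { carrier := {f | ∀ x, 0 ≤ f x}
      add_mem' := fun hf hg x => add_nonneg (hf x) (hg x)
      zero_mem' := fun x => le_rfl
      smul_mem' := fun c f hf x => mul_nonneg c.2 (hf x) }
  let f : C_c(Ω, ℝ) →ₗ.[ℝ] ℝ := ⟨LinearMap.range restrictTest, Λ ∘ₗ e.symm.toLinearMap⟩
  have hf (φ : 𝓓(Ω, ℝ)) : f ⟨restrictTest φ, ⟨φ, rfl⟩⟩ = Λ φ :=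
    congrArg Λ (e.symm_apply_apply φ)
  -- M. Riesz extension from the restricted test functions. Its domination condition is met by `C
  -- φ`, with `φ ≥ 1` on the support of `y` and `C` a bound for `|y|`.
  obtain ⟨g, hg, hg0⟩ := riesz_extension s f
    (by
      rintro ⟨_, φ, rfl⟩ hφ
      rw [hf]
      refine hΛ φ fun x => ?_
      by_cases hx : x ∈ Ω
      · exact hφ (⟨x, hx⟩ : Ω)
      · rw [image_eq_zero_of_notMem_tsupport fun h => hx (φ.tsupport_subset h)])
    (by
      intro y
      obtain ⟨φ, hφ0, hφ1⟩ := exists_testFunction_ge_one (Ω := Ω)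
        (y.hasCompactSupport.isCompact.image continuous_subtype_val)
        (by rintro _ ⟨x, -, rfl⟩; exact x.2)
      obtain ⟨C, hC⟩ := y.continuous.bounded_above_of_compact_support y.hasCompactSupport
      refine ⟨⟨restrictTest (C • φ), ⟨C • φ, rfl⟩⟩, fun x => ?_⟩
      change 0 ≤ C * φ x + y x
      have h1 : -C ≤ y x := neg_le_of_abs_le (hC x)
      have hC0 : 0 ≤ C := (norm_nonneg _).trans (hC x)
      by_cases hx : x ∈ tsupport y
      · have := mul_le_mul_of_nonneg_left (hφ1 x ⟨x, hx, rfl⟩) hC0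
        linarith
      · rw [image_eq_zero_of_notMem_tsupport hx, add_zero]
        exact mul_nonneg hC0 (hφ0 x))
  exact ⟨PositiveLinearMap.mk₀ g fun y hy => hg0 y hy, fun φ => (hg ⟨restrictTest φ, ⟨φ, rfl⟩⟩).trans (hf φ)⟩

/-- A positive functional on test functions is the integral against a measure. -/
theorem exists_measure_of_positive (Λ : 𝓓(Ω, ℝ) →ₗ[ℝ] ℝ)
    (hΛ : ∀ φ : 𝓓(Ω, ℝ), (∀ x, 0 ≤ φ x) → 0 ≤ Λ φ) :
    ∃ μ : Measure (Hn n), SigmaFinite μ ∧ (∀ K : Set (Hn n), IsCompact K → K ⊆ Ω → μ K < ⊤) ∧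
      ∀ φ : 𝓓(Ω, ℝ), Λ φ = ∫ x, φ x ∂μ := by
  obtain ⟨g, hg⟩ := exists_positive_extension Λ hΛ
  have hme : MeasurableEmbedding (Subtype.val : Ω → Hn n) :=
    MeasurableEmbedding.subtype_coe Ω.isOpen.measurableSet
  have : LocallyCompactSpace Ω := Ω.isOpen.locallyCompactSpace
  let ν := RealRMK.rieszMeasure g
  refine ⟨ν.map Subtype.val, hme.sigmaFinite_map, fun K hK hKΩ => ?_, fun φ => ?_⟩
  · rw [hme.map_apply]
    have h : IsCompact ((Subtype.val : Ω → Hn n) ⁻¹' K) :=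
      Topology.IsEmbedding.subtypeVal.isInducing.isCompact_preimage' hK (by simpa using hKΩ)
    exact h.measure_lt_top
  · rw [hme.integral_map, ← hg, ← RealRMK.integral_rieszMeasure]
    rfl

end QuatPluripotential

end

noncomputable section

namespace QuatPluripotential

open scoped ContDiff ENNReal
open MeasureTheory Filter

variable {n : ℕ} {Ω : TopologicalSpace.Opens (Hn n)}

/-! ### Positive currents have measure coefficients -/

/-- The test form `φ ξ`, for a test function `φ` and a constant form `ξ`. -/
def constForm {p : ℕ} (ξ : Ext n p) : 𝓓(Ω, ℂ) →L[ℂ] TestForm Ω p :=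
  TestFunction.postcompCLM (ContinuousLinearMap.toSpanSingleton ℂ ξ)

lemma constForm_add {p : ℕ} (ξ₁ ξ₂ : Ext n p) (φ : 𝓓(Ω, ℂ)) :
    constForm (ξ₁ + ξ₂) φ = constForm ξ₁ φ + constForm ξ₂ φ := by
  ext1 x
  exact smul_add (φ x) ξ₁ ξ₂

lemma constForm_smul {p : ℕ} (c : ℂ) (ξ : Ext n p) (φ : 𝓓(Ω, ℂ)) :
    constForm (c • ξ) φ = c • constForm ξ φ := by
  ext1 x
  exact smul_comm (φ x) c ξ

/-- A real test function as a complex one. -/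
def ofRealTest : 𝓓(Ω, ℝ) →L[ℝ] 𝓓(Ω, ℂ) := TestFunction.postcompCLM Complex.ofRealCLM

/-- The real part of a complex test function. -/
def reTest : 𝓓(Ω, ℂ) →L[ℝ] 𝓓(Ω, ℝ) := TestFunction.postcompCLM Complex.reCLM

/-- The imaginary part of a complex test function. -/
def imTest : 𝓓(Ω, ℂ) →L[ℝ] 𝓓(Ω, ℝ) := TestFunction.postcompCLM Complex.imCLM

lemma ofRealTest_reTest_add (φ : 𝓓(Ω, ℂ)) :
    ofRealTest (reTest φ) + Complex.I • ofRealTest (imTest φ) = φ := by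
  ext1 x
  change ((φ x).re : ℂ) + Complex.I * ((φ x).im : ℂ) = φ x
  rw [mul_comm, Complex.re_add_im]

/-- A functional on test functions that is the integration against a complex measure. -/
def IsMeasureFunctional (Ω : TopologicalSpace.Opens (Hn n)) (Λ : 𝓓(Ω, ℂ) → ℂ) : Prop :=
  ∃ (μ : Measure (Hn n)) (h : Hn n → ℂ), SigmaFinite μ ∧
    LocallyIntegrableOn h (Ω : Set (Hn n)) μ ∧ ∀ φ : 𝓓(Ω, ℂ), Λ φ = ∫ x, φ x * h x ∂μ

lemma integrable_test_mul {μ : Measure (Hn n)} {h : Hn n → ℂ}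
    (hh : LocallyIntegrableOn h (Ω : Set (Hn n)) μ) (φ : 𝓓(Ω, ℂ)) :
    Integrable (fun x => φ x * h x) μ :=
  φ.integrable_bilin (ContinuousLinearMap.mul ℂ ℂ) hh

lemma locallyIntegrableOn_rnDeriv_smul {μ ν : Measure (Hn n)} [SigmaFinite μ] [SigmaFinite ν]
    (hμν : μ ≪ ν) {h : Hn n → ℂ} (hh : LocallyIntegrableOn h (Ω : Set (Hn n)) μ) :
    LocallyIntegrableOn (fun x => (μ.rnDeriv ν x).toReal • h x) (Ω : Set (Hn n)) ν := by
  rw [locallyIntegrableOn_iff Ω.isOpen.isLocallyClosed] at hh ⊢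
  intro K hKΩ hK
  have := (integrable_rnDeriv_smul_iff hμν).2
    ((integrable_indicator_iff hK.measurableSet).2 (hh K hKΩ hK))
  rw [← integrable_indicator_iff hK.measurableSet]
  refine this.congr (Eventually.of_forall fun x => ?_)
  by_cases hx : x ∈ K <;> simp [hx]

/-- Both functionals are written with densities against `μ₁ + μ₂` by Radon–Nikodym; σ-finiteness is
part of `IsMeasureFunctional` for this purpose. -/
lemma IsMeasureFunctional.add {Λ₁ Λ₂ : 𝓓(Ω, ℂ) → ℂ} (h₁ : IsMeasureFunctional Ω Λ₁)
    (h₂ : IsMeasureFunctional Ω Λ₂) : IsMeasureFunctional Ω (fun φ => Λ₁ φ + Λ₂ φ) := by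
  obtain ⟨μ₁, f₁, hσ₁, hf₁, hΛ₁⟩ := h₁
  obtain ⟨μ₂, f₂, hσ₂, hf₂, hΛ₂⟩ := h₂
  have h1 : μ₁ ≪ μ₁ + μ₂ := Measure.AbsolutelyContinuous.rfl.add_right _
  have h2 : μ₂ ≪ μ₁ + μ₂ := by
    rw [add_comm]; exact Measure.AbsolutelyContinuous.rfl.add_right _
  have hg₁ := locallyIntegrableOn_rnDeriv_smul h1 hf₁
  have hg₂ := locallyIntegrableOn_rnDeriv_smul h2 hf₂
  refine ⟨μ₁ + μ₂, _, inferInstance, hg₁.add hg₂, fun φ => ?_⟩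
  change Λ₁ φ + Λ₂ φ = _
  rw [hΛ₁, hΛ₂, ← integral_rnDeriv_smul h1, ← integral_rnDeriv_smul h2]
  simp only [Pi.add_apply, mul_add, mul_smul_comm]
  rw [integral_add]
  · exact (integrable_test_mul hg₁ φ).congr (Eventually.of_forall fun x => mul_smul_comm _ _ _)
  · exact (integrable_test_mul hg₂ φ).congr (Eventually.of_forall fun x => mul_smul_comm _ _ _)

lemma IsMeasureFunctional.const_mul {Λ : 𝓓(Ω, ℂ) → ℂ} (h : IsMeasureFunctional Ω Λ) (c : ℂ) :
    IsMeasureFunctional Ω (fun φ => c * Λ φ) := by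
  obtain ⟨μ, f, hσ, hf, hΛ⟩ := h
  refine ⟨μ, fun x => c * f x, hσ, hf.smul c, fun φ => ?_⟩
  change c * Λ φ = _
  rw [hΛ, ← integral_const_mul]
  exact integral_congr_ae (Eventually.of_forall fun x => mul_left_comm _ _ _)

/-- A functional on test forms that is real and nonnegative on strongly positive test forms. -/
def IsPositiveFunctional {q : ℕ} (T : TestForm Ω q →L[ℂ] ℂ) : Prop :=
  ∀ η : TestForm Ω q, (∀ x ∈ Ω, IsStronglyPositive (η x)) → 0 ≤ (T η).re ∧ (T η).im = 0

lemma IsPositiveFunctional.apply_constForm {q : ℕ} {T : TestForm Ω q →L[ℂ] ℂ}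
    (hT : IsPositiveFunctional T) {ξ : Ext n q} (hξ : IsStronglyPositive ξ) (φ : 𝓓(Ω, ℝ))
    (hφ : ∀ x, 0 ≤ φ x) :
    0 ≤ (T (constForm ξ (ofRealTest φ))).re ∧ (T (constForm ξ (ofRealTest φ))).im = 0 :=
  hT _ fun x _ => hξ.smul (hφ x)

/-- A real test function is the difference of the nonnegative test functions `φ + C χ` and `C χ`. -/
lemma IsPositiveFunctional.im_apply_constForm {q : ℕ} {T : TestForm Ω q →L[ℂ] ℂ}
    (hT : IsPositiveFunctional T) {ξ : Ext n q} (hξ : IsStronglyPositive ξ) (φ : 𝓓(Ω, ℝ)) :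
    (T (constForm ξ (ofRealTest φ))).im = 0 := by
  obtain ⟨χ, hχ0, hχ1⟩ := exists_testFunction_ge_one φ.hasCompactSupport.isCompact φ.tsupport_subset
  obtain ⟨C, hC⟩ := φ.continuous.bounded_above_of_compact_support φ.hasCompactSupport
  have hC0 : 0 ≤ C := (norm_nonneg _).trans (hC 0)
  have h1 := (hT.apply_constForm hξ (C • χ) fun x => mul_nonneg hC0 (hχ0 x)).2
  have h2 := (hT.apply_constForm hξ (φ + C • χ) fun x => by
    change 0 ≤ φ x + C * χ x
    by_cases hx : x ∈ tsupport φ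
    · have h3 : -C ≤ φ x := neg_le_of_abs_le (hC x)
      have := mul_le_mul_of_nonneg_left (hχ1 x hx) hC0
      linarith
    · rw [image_eq_zero_of_notMem_tsupport hx, zero_add]
      exact mul_nonneg hC0 (hχ0 x)).2
  rw [map_add, map_add, map_add, Complex.add_im, h1, add_zero] at h2
  exact h2

/-- For fixed strongly positive `ξ` the map `φ ↦ T(φ ξ)` is a positive functional on real test
functions, hence a measure; complex `φ` are split into real and imaginary parts. -/
lemma IsPositiveFunctional.isMeasureFunctional {q : ℕ} {T : TestForm Ω q →L[ℂ] ℂ}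
    (hT : IsPositiveFunctional T) {ξ : Ext n q} (hξ : IsStronglyPositive ξ) :
    IsMeasureFunctional Ω (fun φ => T (constForm ξ φ)) := by
  let Λ : 𝓓(Ω, ℝ) →ₗ[ℝ] ℝ :=
    { toFun := fun φ => (T (constForm ξ (ofRealTest φ))).re
      map_add' := fun φ ψ => by rw [map_add, map_add, map_add, Complex.add_re]
      map_smul' := fun c φ => by
        have : ofRealTest (c • φ) = (c : ℂ) • ofRealTest φ := by
          ext1 x
          change ((c * φ x : ℝ) : ℂ) = c * (φ x : ℂ)
          push_cast
          rfl
        rw [this, map_smul, map_smul, smul_eq_mul, Complex.re_ofReal_mul]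
        rfl }
  obtain ⟨μ, hσ, hfin, hμ⟩ :=
    exists_measure_of_positive Λ fun φ hφ => (hT.apply_constForm hξ φ hφ).1
  have hreal (φ : 𝓓(Ω, ℝ)) : T (constForm ξ (ofRealTest φ)) = ((∫ x, φ x ∂μ : ℝ) : ℂ) := by
    rw [← hμ]
    exact Complex.ext rfl (hT.im_apply_constForm hξ φ)
  have hloc : LocallyIntegrableOn (fun _ : Hn n => (1 : ℂ)) (Ω : Set (Hn n)) μ := by
    rw [locallyIntegrableOn_iff Ω.isOpen.isLocallyClosed]
    exact fun K hKΩ hK => integrableOn_const (hfin K hK hKΩ).ne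
  refine ⟨μ, fun _ => 1, hσ, hloc, fun φ => ?_⟩
  have hfi := integrable_test_mul hloc φ
  rw [← integral_re_add_im hfi]
  change T (constForm ξ φ) = _
  conv_lhs => rw [← ofRealTest_reTest_add φ]
  rw [map_add, map_add, map_smul, map_smul, hreal, hreal, smul_eq_mul]
  simp only [mul_one]
  rw [mul_comm]
  rfl

/-- Positive functionals on test forms of even degree have measure coefficients. -/
theorem IsPositiveFunctional.exists_representation {r q : ℕ} (hq : q = 2 * r)
    {T : TestForm Ω q →L[ℂ] ℂ} (hT : IsPositiveFunctional T) :
    ∃ (μ : MultiIndex n q → Measure (Hn n)) (h : MultiIndex n q → Hn n → ℂ),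
      (∀ J, LocallyIntegrableOn (h J) (Ω : Set (Hn n)) (μ J)) ∧
        ∀ φ : TestForm Ω q, T φ = ∑ J, ∫ x, φ x J * h J x ∂(μ J) := by
  subst hq
  -- Strongly positive elements span in even degree, so linearity reaches every `ξ`, in particular
  -- the basis elements.
  have key (ξ : Ext n (2 * r)) : IsMeasureFunctional Ω (fun φ => T (constForm ξ φ)) := by
    have hmem : ξ ∈ spSpan n (2 * r) := by rw [spSpan_even]; trivial
    induction hmem using Submodule.span_induction with
    | mem ξ hξ => exact hT.isMeasureFunctional hξ
    | zero =>
      have h0 : IsMeasureFunctional Ω (fun φ => T (constForm (0 : Ext n (2 * r)) φ)) :=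
        hT.isMeasureFunctional isStronglyPositive_zero
      exact h0
    | add ξ₁ ξ₂ _ _ h₁ h₂ =>
      simpa only [constForm_add, map_add] using h₁.add h₂
    | smul c ξ _ h =>
      simpa only [constForm_smul, map_smul, smul_eq_mul] using h.const_mul c
  choose μ h _ hloc hrep using fun J : MultiIndex n (2 * r) => key (Pi.single J 1)
  refine ⟨μ, h, hloc, fun φ => ?_⟩
  have hφ : φ = ∑ J, constForm (Pi.single J 1)
      (TestFunction.postcompCLM (ContinuousLinearMap.proj (R := ℂ) J) φ) := by
    ext1 x
    have hsum : (∑ J, constForm (Pi.single J 1)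
        (TestFunction.postcompCLM (ContinuousLinearMap.proj (R := ℂ) J) φ)) x =
          ∑ J, φ x J • (Pi.single J 1 : Ext n (2 * r)) := by
      rw [sum_apply]
      rfl
    rw [hsum]
    ext J
    simp [Finset.sum_apply, Pi.single_apply]
  conv_lhs => rw [hφ]
  rw [map_sum]
  exact Finset.sum_congr rfl fun J _ => hrep J _

/-! ### The product of a locally bounded plurisubharmonic function and a current -/

/-- The product of a smooth function and a test form. -/
def smulForm {q : ℕ} (v : Hn n → ℝ) (hv : ContDiff ℝ ∞ v) (φ : TestForm Ω q) : TestForm Ω q :=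
  testFormOf φ (fun x => (v x : ℂ) • φ x)
    ((Complex.ofRealCLM.contDiff.comp hv).smul φ.contDiff) fun x hx => by simp [hx]

lemma smulForm_apply {q : ℕ} (v : Hn n → ℝ) (hv : ContDiff ℝ ∞ v) (φ : TestForm Ω q) (x : Hn n) :
    smulForm v hv φ x = (v x : ℂ) • φ x := rfl

/-- The functionals `T` and `S` on test forms have measure coefficients, those of `S` being `u` times
those of `T`. -/
def IsFunctionalProduct {q : ℕ} (u : Hn n → ℝ) (T S : TestForm Ω q →L[ℂ] ℂ) : Prop :=
  ∃ (μ : MultiIndex n q → Measure (Hn n)) (h : MultiIndex n q → Hn n → ℂ),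
    ((∀ J, LocallyIntegrableOn (h J) (Ω : Set (Hn n)) (μ J)) ∧
      ∀ φ : TestForm Ω q, T φ = ∑ J, ∫ x, φ x J * h J x ∂(μ J)) ∧
    (∀ J, LocallyIntegrableOn (fun x => (u x : ℂ) * h J x) (Ω : Set (Hn n)) (μ J)) ∧
      ∀ φ : TestForm Ω q, S φ = ∑ J, ∫ x, φ x J * ((u x : ℂ) * h J x) ∂(μ J)

/-- The `J`-th coefficient of a test form. -/
def testCoeff {q : ℕ} (J : MultiIndex n q) : TestForm Ω q →L[ℂ] 𝓓(Ω, ℂ) :=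
  TestFunction.postcompCLM (ContinuousLinearMap.proj (R := ℂ) J)

/-- The value of `uT` is the limit of the values of `v_i T` for smooth functions `v_i` that tend to
`u` boundedly. -/
lemma IsFunctionalProduct.tendsto {q : ℕ} {u : Hn n → ℝ} {T S : TestForm Ω q →L[ℂ] ℂ}
    (hS : IsFunctionalProduct u T S) (φ : TestForm Ω q) {v : ℕ → Hn n → ℝ} {M : ℝ}
    (hv : ∀ i, ContDiff ℝ ∞ (v i)) (hM : ∀ i x, |v i x| ≤ M)
    (hlim : ∀ x ∈ tsupport φ, Tendsto (fun i => v i x) atTop (nhds (u x))) :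
    Tendsto (fun i => T (smulForm (v i) (hv i) φ)) atTop (nhds (S φ)) := by
  obtain ⟨μ, h, ⟨hloc, hT⟩, -, hS⟩ := hS
  simp only [hT, hS]
  refine tendsto_finsetSum _ fun J _ => ?_
  have hfi := integrable_test_mul (hloc J) (testCoeff J φ)
  have hfi' (i : ℕ) := integrable_test_mul (hloc J) (testCoeff J (smulForm (v i) (hv i) φ))
  refine tendsto_integral_of_dominated_convergence (fun x => M * ‖φ x J * h J x‖)
    (fun i => (hfi' i).aestronglyMeasurable) (hfi.norm.const_mul M)
    (fun i => Eventually.of_forall fun x => ?_) (Eventually.of_forall fun x => ?_)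
  · rw [smulForm_apply, Pi.smul_apply, smul_eq_mul, mul_assoc, norm_mul, Complex.norm_real]
    exact mul_le_mul_of_nonneg_right (hM i x) (norm_nonneg _)
  · have : φ x J * ((u x : ℂ) * h J x) = (u x : ℂ) * (φ x J * h J x) := mul_left_comm _ _ _
    rw [this]
    simp only [smulForm_apply, Pi.smul_apply, smul_eq_mul, mul_assoc]
    by_cases hx : x ∈ tsupport φ
    · exact ((Complex.continuous_ofReal.tendsto _).comp (hlim x hx)).mul_const _
    · rw [image_eq_zero_of_notMem_tsupport hx]
      simp

/-- Nothing is known about `u` outside `Ω`, so measurability and bounds enter through cut-offs to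
compact subsets. -/
lemma locallyIntegrableOn_toReal_mul {u : Hn n → EReal} (hu : UpperSemicontinuousOn u (Ω : Set (Hn n)))
    (hlb : IsLocallyBounded Ω u) {μ : Measure (Hn n)} {h : Hn n → ℂ}
    (hh : LocallyIntegrableOn h (Ω : Set (Hn n)) μ) :
    LocallyIntegrableOn (fun x => ((u x).toReal : ℂ) * h x) (Ω : Set (Hn n)) μ := by
  rw [locallyIntegrableOn_iff Ω.isOpen.isLocallyClosed] at hh ⊢
  intro K hKΩ hK
  obtain ⟨M, hM⟩ := hlb.exists_bound hK hKΩ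
  have hmeas := measurable_indicator_toReal hu hK.isClosed hKΩ
  have := Integrable.bdd_mul (c := M) (hh K hKΩ hK)
    (f := fun x => ((K.indicator (fun x => (u x).toReal) x : ℝ) : ℂ))
    (Complex.measurable_ofReal.comp hmeas).aestronglyMeasurable
    ((ae_restrict_iff' hK.measurableSet).2 (Eventually.of_forall fun x hx => by
      rw [Complex.norm_real, Set.indicator_of_mem hx]
      exact (coe_toReal_of_mem_Icc (hM x hx)).2))
  refine IntegrableOn.congr_fun this (fun x hx => ?_) hK.measurableSet
  simp only [Set.indicator_of_mem hx]

/-- The product of a locally bounded plurisubharmonic function and a positive functional on test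
forms of even degree exists and is unique. -/
theorem IsPositiveFunctional.existsUnique_product {r q : ℕ} (hq : q = 2 * r)
    {T : TestForm Ω q →L[ℂ] ℂ} (hT : IsPositiveFunctional T) {u : Hn n → EReal} (hu : IsPSH Ω u)
    (hlb : IsLocallyBounded Ω u) : ∃! S, IsFunctionalProduct (fun x => (u x).toReal) T S := by
  refine existsUnique_of_exists_of_unique ?_ fun S S' hS hS' => ?_
  · obtain ⟨μ, h, hloc, hrep⟩ := hT.exists_representation hq
    have hloc' (J) := locallyIntegrableOn_toReal_mul hu.1 hlb (hloc J)
    refine ⟨∑ J, TestFunction.integralAgainstBilinCLM (ContinuousLinearMap.mul ℂ ℂ) (μ J)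
      (fun x => ((u x).toReal : ℂ) * h J x) ∘L testCoeff J, μ, h, ⟨hloc, hrep⟩, hloc', fun φ => ?_⟩
    rw [sum_apply]
    exact Finset.sum_congr rfl fun J _ =>
      TestFunction.integralAgainstBilinCLM_eq_integral (hloc' J)
  -- Two products may use different representations of `T`, but both are limits of the same numbers
  -- `T(v_i φ)`.
  · ext1 φ
    obtain ⟨v, M, hv, hM, hlim, -⟩ :=
      hu.exists_smooth_approx hlb φ.hasCompactSupport.isCompact φ.tsupport_subset
    exact tendsto_nhds_unique (hS.tendsto φ hv hM hlim) (hS'.tendsto φ hv hM hlim)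

/-! ### Positivity of `△(uT)` -/

lemma fderiv_fderiv_ofReal {v : Hn n → ℝ} (hv : ContDiff ℝ ∞ v) (x y z : Hn n) :
    fderiv ℝ (fderiv ℝ fun t => (v t : ℂ)) x y z = (fderiv ℝ (fderiv ℝ v) x y z : ℂ) := by
  have h1 : (fderiv ℝ fun t => (v t : ℂ)) = fun t => Complex.ofRealCLM.comp (fderiv ℝ v t) := by
    ext1 t
    exact (Complex.ofRealCLM.hasFDerivAt.comp t
      (hv.differentiable (by simp) t).hasFDerivAt).fderiv
  have hd : DifferentiableAt ℝ (fderiv ℝ v) x :=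
    (hv.fderiv_right (m := ∞) (by simp)).differentiable (by simp) x
  have h2 : HasFDerivAt (fun t => Complex.ofRealCLM.comp (fderiv ℝ v t))
      ((ContinuousLinearMap.compL ℝ (Hn n) ℝ ℂ Complex.ofRealCLM).comp (fderiv ℝ (fderiv ℝ v) x)) x :=
    (ContinuousLinearMap.compL ℝ (Hn n) ℝ ℂ Complex.ofRealCLM).hasFDerivAt.comp x hd.hasFDerivAt
  rw [h1, h2.fderiv]
  rfl

lemma nablaFun_nablaFun_ofReal {v : Hn n → ℝ} (hv : ContDiff ℝ ∞ v) (k j : Fin (2 * n)) (x : Hn n) :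
    nablaFun k 0 (nablaFun j 1 fun t => (v t : ℂ)) x =
      hessCoeff (fun y z => fderiv ℝ (fderiv ℝ v) x y z) k j := by
  rw [nablaFun_nablaFun k j 0 1 (f := fun t => (v t : ℂ)) (Complex.ofRealCLM.contDiff.comp hv) x]
  simp only [fderiv_fderiv_ofReal hv, hessCoeff, smul_eq_mul]

/-- If `T` is closed and positive, then `△(uT)` is positive. -/
theorem IsFunctionalProduct.laplace_nonneg {m q₁ q₂ : ℕ} (h₁ : q₁ = m + 1) (h₂ : q₂ = m + 2)
    {T S : TestForm Ω q₂ →L[ℂ] ℂ} (hT : IsPositiveFunctional T)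
    (hTc : ∀ α (ψ : TestForm Ω q₁), T (dForm q₁ q₂ α ψ) = 0) {u : Hn n → EReal} (hu : IsPSH Ω u)
    (hlb : IsLocallyBounded Ω u) (hS : IsFunctionalProduct (fun x => (u x).toReal) T S)
    (η : TestForm Ω m) (hη : ∀ x ∈ Ω, IsStronglyPositive (η x)) :
    0 ≤ (S (dForm q₁ q₂ 0 (dForm m q₁ 1 η))).re ∧ (S (dForm q₁ q₂ 0 (dForm m q₁ 1 η))).im = 0 := by
  -- The degrees enter as variables with equations because those of currents are truncated
  -- differences.
  subst h₁ h₂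
  set φ := dForm (m + 1) (m + 2) 0 (dForm m (m + 1) 1 η) with hφ
  obtain ⟨v, M, hv, hM, hlim, hpos⟩ := hu.exists_smooth_approx hlb
    -- Convergence is needed on the support of `φ`, nonnegativity of the Hessian on that of `η`.
    (η.hasCompactSupport.isCompact.union φ.hasCompactSupport.isCompact)
    (Set.union_subset η.tsupport_subset φ.tsupport_subset)
  have htend := hS.tendsto φ hv hM fun x hx => hlim x (Or.inr hx)
  have key (i : ℕ) : 0 ≤ (T (smulForm (v i) (hv i) φ)).re ∧
      (T (smulForm (v i) (hv i) φ)).im = 0 := by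
    have hvc : ContDiff ℝ ∞ fun t => (v i t : ℂ) := Complex.ofRealCLM.contDiff.comp (hv i)
    -- This is `△v_i ∧ η`, with which integration by parts replaces `v_i △η`.
    let Θ : TestForm Ω (m + 2) := testFormOf η (fun x => ∑ k, ∑ j,
        nablaFun k 0 (nablaFun j 1 fun t => (v i t : ℂ)) x •
          leftWedge (m + 1) (m + 2) k (leftWedge m (m + 1) j (η x)))
      (ContDiff.sum fun k _ => ContDiff.sum fun j _ =>
        (contDiff_nablaFun k 0 (contDiff_nablaFun j 1 hvc)).smul
          (contDiff_leftWedge_comp k (contDiff_leftWedge_comp j η.contDiff)))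
      (fun x hx => by simp [hx])
    rw [closed_apply_smul_laplace T hTc hvc η (smulForm (v i) (hv i) φ) Θ (fun _ => rfl)
      fun _ => rfl]
    refine hT Θ fun x hx => ?_
    change IsStronglyPositive (∑ k, ∑ j, nablaFun k 0 (nablaFun j 1 fun t => (v i t : ℂ)) x •
          leftWedge (m + 1) (m + 2) k (leftWedge m (m + 1) j (η x)))
    by_cases hxη : x ∈ tsupport η
    · simp only [nablaFun_nablaFun_ofReal (hv i)]
      exact isStronglyPositive_hess_wedge (fderiv ℝ (fderiv ℝ (v i)) x)
        ((hv i).contDiffAt.isSymmSndFDerivAt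
          (by simpa using WithTop.coe_le_coe.2 (le_top (a := (2 : ℕ∞)))))
        (hpos i x (Or.inl hxη)) (hη x hx)
    · simp only [image_eq_zero_of_notMem_tsupport hxη, map_zero, smul_zero, Finset.sum_const_zero]
      exact isStronglyPositive_zero
  refine ⟨ge_of_tendsto ((Complex.continuous_re.tendsto _).comp htend)
    (Eventually.of_forall fun i => (key i).1), ?_⟩
  refine tendsto_nhds_unique ((Complex.continuous_im.tendsto _).comp htend) ?_
  simp only [Function.comp_def, (key _).2]
  exact tendsto_const_nhds

end QuatPluripotential

end

noncomputable section

namespace QuatPluripotential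

variable {n : ℕ} {Ω : TopologicalSpace.Opens (Hn n)}

/-! ### Products of currents -/

namespace Current

lemma IsClosed.apply_dForm {p : ℕ} {T : Current Ω p} (hT : T.IsClosed) (α : Fin 2)
    (ψ : TestForm Ω (2 * n - (p + 1))) : T (dForm _ _ α ψ) = 0 :=
  neg_eq_zero.1 (DFunLike.congr_fun (hT α) ψ)

lemma IsPositive.existsUnique_isProduct {k : ℕ} {T : Current Ω (2 * k)} (hT : T.IsPositive)
    {u : Hn n → EReal} (hu : IsPSH Ω u) (hlb : IsLocallyBounded Ω u) :
    ∃! S : Current Ω (2 * k), IsProduct (fun x => (u x).toReal) T S :=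
  IsPositiveFunctional.existsUnique_product (r := n - k) (by omega) hT hu hlb

lemma isProduct_mul {p : ℕ} {T : Current Ω p} {u : Hn n → ℝ} (h : ∃ S, IsProduct u T S) :
    IsProduct u T (mul u T) := by
  rw [mul, dif_pos h]
  exact h.choose_spec

lemma isClosed_laplaceWedge {p : ℕ} (u : Hn n → EReal) (T : Current Ω p) :
    (laplaceWedge u T).IsClosed :=
  isClosed_laplace _

/-- `△u ∧ T` is positive if `T` is closed and positive and `u` is plurisubharmonic and locally
bounded. -/
lemma isPositive_laplaceWedge {k : ℕ} {T : Current Ω (2 * k)} (hTc : T.IsClosed)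
    (hT : T.IsPositive) {u : Hn n → EReal} (hu : IsPSH Ω u) (hlb : IsLocallyBounded Ω u) :
    (laplaceWedge u T).IsPositive := by
  intro η hη
  change 0 ≤ (mul _ T (dForm _ _ 0 (dForm _ _ 1 η))).re ∧
    (mul _ T (dForm _ _ 0 (dForm _ _ 1 η))).im = 0
  -- Above top degree both truncated degrees are 0, so the inner `dForm` is the zero map and the
  -- current vanishes.
  by_cases h : 2 * k + 2 ≤ 2 * n
  · exact IsFunctionalProduct.laplace_nonneg (by omega) (by omega) hT hTc.apply_dForm hu hlb
      (isProduct_mul (hT.existsUnique_isProduct hu hlb).exists) η hη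
  · rw [dForm_eq_zero (p := 2 * n - (2 * k + 2)) (by omega)]
    simp

/-- `△u₁ ∧ ⋯ ∧ △u_m ∧ T` is closed and positive. -/
lemma isClosed_and_isPositive_laplaceWedges {k : ℕ} {T : Current Ω (2 * k)} (hTc : T.IsClosed)
    (hT : T.IsPositive) (m : ℕ) (u : Fin m → Hn n → EReal) (hu : ∀ i, IsPSH Ω (u i))
    (hlb : ∀ i, IsLocallyBounded Ω (u i)) :
    (laplaceWedges T m u).IsClosed ∧ (laplaceWedges T m u).IsPositive := by
  -- The degree `2 * k + 2 * m` is not syntactically twice a number, so it is kept as a variable `p`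
  -- until `subst`.
  have key (m : ℕ) (p : ℕ) (hp : p = 2 * (k + m)) (F : Current Ω p) (hFc : F.IsClosed)
      (hF : F.IsPositive) (u : Hn n → EReal) (hu : IsPSH Ω u) (hlb : IsLocallyBounded Ω u) :
      (laplaceWedge u F).IsPositive := by
    subst hp
    exact isPositive_laplaceWedge hFc hF hu hlb
  induction m with
  | zero => exact ⟨hTc, hT⟩
  | succ m ih =>
    obtain ⟨h1, h2⟩ := ih (Fin.tail u) (fun i => hu i.succ) (fun i => hlb i.succ)
    exact ⟨isClosed_laplaceWedge _ _,
      key m _ (by ring) _ h1 h2 (u 0) (hu 0) (hlb 0)⟩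

end Current

end QuatPluripotential

end

open QuatPluripotential in
theorem proposition3p7 {n k : ℕ} (hk : k ≤ n) (Ω : TopologicalSpace.Opens (Hn n))
    (T : Current Ω (2 * k)) (hTclosed : T.IsClosed) (hTpos : T.IsPositive) :
    (∀ u : Hn n → EReal, IsPSH Ω u → IsLocallyBounded Ω u →
      (∃! S : Current Ω (2 * k), Current.IsProduct (fun x => (u x).toReal) T S) ∧
        (Current.laplaceWedge u T).IsClosed ∧ (Current.laplaceWedge u T).IsPositive) ∧
    ∀ (p : ℕ) (u : Fin p → Hn n → EReal),
      (∀ i, IsPSH Ω (u i)) → (∀ i, IsLocallyBounded Ω (u i)) →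
        (Current.laplaceWedges T p u).IsClosed ∧ (Current.laplaceWedges T p u).IsPositive :=
  ⟨fun _ hu hlb => ⟨hTpos.existsUnique_isProduct hu hlb, Current.isClosed_laplaceWedge _ _,
    Current.isPositive_laplaceWedge hTclosed hTpos hu hlb⟩,
    Current.isClosed_and_isPositive_laplaceWedges hTclosed hTpos⟩
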